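/- Let $1\le k\le n$ be integers, $\alpha>0$ and $\lambda\in(0,1)$. Let $p_1,\dots,p_n$ be independent real random variables (the $p$-values of null hypotheses $H_1,\dots,H_n$), and let $I_0\subseteq\{1,\dots,n\}$ be the set of indices of the true null hypotheses; assume that $p_i$ is uniformly distributed on $(0,1)$ for every $i\in I_0$. No assumption is made on the laws of the other $p_i$. For $0<t<1$ put $$\tilde G_{k,n}(t)=t\sum_{m=k-1}^{n-1}\binom{n-1}{m}t^m(1-t)^{n-1-m},$$ an increasing bijection of $(0,1)$ onto itself, and let $\tilde G_{k,n}^{-1}$ be its inverse, with the convention $\tilde G_{k,n}^{-1}(y)=y$ for $y\ge 1$. Let $p_{1:n}\le\dots\le p_{n:n}$ be the sorted $p$-values and $H_{(i)}$ the null hypothesis corresponding to $p_{i:n}$. Consider the following two-stage procedure. First find $$j=\max\{1\le i\le n:\ p_{i:n}\le\lambda\},$$ then reject $H_{(1)},\dots,H_{(\hat l)}$, where $$\hat l=\max\Bigl\{1\le i\le j:\ p_{i:n}\le\lambda\min\Bigl[\tilde G_{k,n}^{-1}\Bigl(\frac{i\alpha(1-\lambda)}{\lambda(n-j+1)}\Bigr),1\Bigr]\Bigr\};$$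 if the maximum does not exist at either stage, reject nothing. Let $R$ be the number of rejected hypotheses and $V$ the number of rejected true null hypotheses. Then the procedure controls the $k$-FDR at level $\alpha$, that is, $$k\text{-FDR}=E\left[\frac{V\,\mathbf 1(V\ge k)}{\max(R,1)}\right]\le\alpha .$$ -/

import Mathlib

open MeasureTheory ProbabilityTheory

noncomputable section

namespace KFDR

/-- The binomial upper tail `G(k, n, u) = ∑_{j=k}^n C(n,j) u^j (1-u)^(n-j)`. -/
def G (k n : ℕ) (u : ℝ) : ℝ :=
  ∑ j ∈ Finset.Icc k n, (n.choose j : ℝ) * u ^ j * (1 - u) ^ (n - j)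

/-- The function `t ↦ t * G(k-1, n-1, t)`, considered on `(0, 1)`, for `1 ≤ k ≤ n`. -/
def Gtilde (k n : ℕ) (t : ℝ) : ℝ :=
  t * G (k - 1) (n - 1) t

/-- The inverse of `Gtilde k n`. For `1 ≤ k ≤ n`, `Gtilde k n` is an increasing bijection of
`(0, 1)` onto itself. Since the binomial tail is a distribution function, equal to `1` from `t = 1`
on, `Gtilde k n` extends to the identity on `[1, ∞)`, and so does its inverse. -/
def GtildeInv (k n : ℕ) (y : ℝ) : ℝ :=
  if y < 1 then Function.invFunOn (Gtilde k n) (Set.Ioo 0 1) y else y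

/-- `H_(i+1)`: the index of the hypothesis with the `(i+1)`-th smallest p-value (ranks are counted
from `0` here). -/
def ranked {n : ℕ} (p : Fin n → ℝ) (i : Fin n) : Fin n :=
  Tuple.sort p i

/-- `p_{i+1:n}`: the `(i+1)`-th smallest p-value. -/
def orderStat {n : ℕ} (p : Fin n → ℝ) (i : Fin n) : ℝ :=
  p (ranked p i)

/-- The first stage: `j = max {1 ≤ i ≤ n : p_{i:n} ≤ lam}`, with `0` if there is no such `i`. -/
def firstStage {n : ℕ} (lam : ℝ) (p : Fin n → ℝ) : ℕ :=
  (Finset.univ.filter fun i : Fin n => orderStat p i ≤ lam).sup fun i => (i : ℕ) + 1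

/-- The critical values
`lam * min [GtildeInv (i * α * (1 - lam) / (lam * (n - j + 1))), 1]`. -/
def crit (k n : ℕ) (α lam : ℝ) (i j : ℕ) : ℝ :=
  lam * min (GtildeInv k n ((i : ℝ) * α * (1 - lam) / (lam * ((n : ℝ) - (j : ℝ) + 1)))) 1

/-- The second stage: the largest `1 ≤ i ≤ j` such that `p_{i:n}` is at most the `i`-th critical
value, with `0` if there is no such `i`. -/
def secondStage {n : ℕ} (k : ℕ) (α lam : ℝ) (p : Fin n → ℝ) : ℕ :=
  (Finset.univ.filter fun i : Fin n =>
    (i : ℕ) + 1 ≤ firstStage lam p ∧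
      orderStat p i ≤ crit k n α lam ((i : ℕ) + 1) (firstStage lam p)).sup fun i => (i : ℕ) + 1

/-- The set of hypotheses rejected by the two-stage adaptive procedure, `H_(1), …, H_(l)` with
`l = secondStage k α lam p`. -/
def rejected {n : ℕ} (k : ℕ) (α lam : ℝ) (p : Fin n → ℝ) : Finset (Fin n) :=
  (Finset.univ.filter fun i : Fin n => (i : ℕ) < secondStage k α lam p).image (ranked p)

/-- The `k`-FDP `V 1(V ≥ k) / max(R, 1)` of a rejection set `rej`, where `nulls` is the set of true
null hypotheses, `V = #(rej ∩ nulls)` and `R = #rej`. -/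
def kFDP {n : ℕ} (k : ℕ) (nulls rej : Finset (Fin n)) : ℝ :=
  (if k ≤ (rej ∩ nulls).card then ((rej ∩ nulls).card : ℝ) else 0) / max (rej.card : ℝ) 1

/-- A multiple testing procedure `proc`, applied to the random p-values `p` with true nulls
`nulls`, controls the `k`-FDR at level `α`: the `k`-FDP has an expectation and it is at most `α`. -/
def ControlsKFDR {Ω : Type*} [MeasurableSpace Ω] (μ : Measure Ω) {n : ℕ} (k : ℕ) (α : ℝ)
    (nulls : Finset (Fin n)) (p : Fin n → Ω → ℝ)
    (proc : (Fin n → ℝ) → Finset (Fin n)) : Prop :=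
  Integrable (fun ω => kFDP k nulls (proc fun i => p i ω)) μ ∧
    ∫ ω, kFDP k nulls (proc fun i => p i ω) ∂μ ≤ α

end KFDR

end

/-!
Condition on the set `W` of hypotheses selected by the first stage. Given `W`, the p-values in `W`
divided by `λ` are again independent, the null ones uniform, and the second stage is a step-up
procedure on them whose critical values no longer depend on the data.

For such a procedure, with `V r` true nulls below the `r`-th critical value, write the `k`-FDR as a
sum over the number `R = r` of rejections and compare `E[V r 1(V r ≥ k); R ≥ r]` with its
unrestricted value `E[V r 1(V r ≥ k)] = N Gtilde k N (c r)`, where `N` is the number of true nulls.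
The ratio of the two decreases in `r`, so the sum telescopes and the `k`-FDR is at most `N γ`
whenever `Gtilde k N (c r) ≤ r γ`. The ratio decreases by a correlation inequality: rejecting more
nulls at a given level makes `R ≥ r` more likely, and averaging over sets of rejections of a given
size reduces this to Chebyshev's sum inequality.

It remains to average the bound `#(W ∩ nulls) α (1 - λ) / (λ (n - #W + 1))` over `W`; as
`n - #W ≥ #(nulls \ W)`, this is a computation with a binomial variable.
-/

namespace KFDR

open Finset

/-! ### The binomial tail -/

lemma G_zero (n : ℕ) (u : ℝ) : G 0 n u = 1 := by
  have h := add_pow u (1 - u) n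
  rw [add_sub_cancel, one_pow] at h
  rw [h, G, ← Nat.range_succ_eq_Icc_zero]
  exact sum_congr rfl fun i _ => by ring

lemma G_of_lt {m n : ℕ} (h : n < m) (u : ℝ) : G m n u = 0 := by
  rw [G, Icc_eq_empty_of_lt h, sum_empty]

lemma G_eq_sum_range (m n : ℕ) (u : ℝ) :
    G m n u
      = ∑ j ∈ range (n + 1), if m ≤ j then (n.choose j : ℝ) * u ^ j * (1 - u) ^ (n - j) else 0 := by
  rw [← sum_filter, G]
  refine sum_congr (ext fun j => ?_) fun _ _ => rfl
  rw [mem_Icc, mem_filter, mem_range, Nat.lt_succ_iff, and_comm]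

lemma G_succ_succ (m n : ℕ) (u : ℝ) :
    G (m + 1) (n + 1) u = u * G m n u + (1 - u) * G (m + 1) n u := by
  have extend : G (m + 1) n u = ∑ j ∈ range (n + 1),
      if m ≤ j then (n.choose (j + 1) : ℝ) * u ^ (j + 1) * (1 - u) ^ (n - (j + 1)) else 0 := by
    rw [G_eq_sum_range, sum_range_succ', sum_range_succ _ n]
    simp
  rw [extend, G_eq_sum_range, G_eq_sum_range, sum_range_succ', mul_sum, mul_sum,
    ← sum_add_distrib]
  simp only [Nat.le_zero, Nat.add_eq_zero_iff, one_ne_zero, and_false, if_false, add_zero,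
    add_le_add_iff_right]
  refine sum_congr rfl fun j hj => ?_
  split_ifs
  · rw [Nat.choose_succ_succ, Nat.add_sub_add_right]
    rcases (Nat.lt_succ_iff.1 (mem_range.1 hj)).eq_or_lt with rfl | h
    · simp
      ring
    · rw [show n - j = n - (j + 1) + 1 by omega]
      push_cast
      ring
  · ring

lemma G_nonneg (m n : ℕ) {u : ℝ} (hu : u ∈ Set.Icc (0 : ℝ) 1) : 0 ≤ G m n u :=
  sum_nonneg fun _ _ =>
    mul_nonneg (mul_nonneg (Nat.cast_nonneg _) (pow_nonneg hu.1 _))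
      (pow_nonneg (sub_nonneg.2 hu.2) _)

lemma G_antitone_left (n : ℕ) {u : ℝ} (hu : u ∈ Set.Icc (0 : ℝ) 1) :
    Antitone fun m => G m n u := fun _ _ h =>
  sum_le_sum_of_subset_of_nonneg (Icc_subset_Icc_left h) fun _ _ _ =>
    mul_nonneg (mul_nonneg (Nat.cast_nonneg _) (pow_nonneg hu.1 _))
      (pow_nonneg (sub_nonneg.2 hu.2) _)

lemma G_monotone_right (m : ℕ) {u : ℝ} (hu : u ∈ Set.Icc (0 : ℝ) 1) :
    Monotone fun n => G m n u := by
  refine monotone_nat_of_le_succ fun n => ?_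
  cases m with
  | zero => rw [G_zero, G_zero]
  | succ m =>
    rw [G_succ_succ]
    nlinarith [hu.1, G_antitone_left n hu m.le_succ]

lemma G_monotoneOn (m n : ℕ) : MonotoneOn (G m n) (Set.Icc 0 1) := by
  induction n generalizing m with
  | zero =>
    cases m with
    | zero => exact fun x _ y _ _ => by rw [G_zero, G_zero]
    | succ m => exact fun x _ y _ _ => by rw [G_of_lt m.succ_pos, G_of_lt m.succ_pos]
  | succ n ih =>
    cases m with
    | zero => exact fun x _ y _ _ => by rw [G_zero, G_zero]
    | succ m =>
      intro x hx y hy hxy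
      rw [G_succ_succ, G_succ_succ]
      calc x * G m n x + (1 - x) * G (m + 1) n x
          ≤ y * G m n x + (1 - y) * G (m + 1) n x := by
            nlinarith [G_antitone_left n hx m.le_succ]
        _ ≤ y * G m n y + (1 - y) * G (m + 1) n y :=
            add_le_add (mul_le_mul_of_nonneg_left (ih m hx hy hxy) hy.1)
              (mul_le_mul_of_nonneg_left (ih (m + 1) hx hy hxy) (sub_nonneg.2 hy.2))

lemma G_pos {m n : ℕ} (h : m ≤ n) {u : ℝ} (hu : u ∈ Set.Ioc (0 : ℝ) 1) : 0 < G m n u := by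
  have := hu.1
  have := sub_nonneg.2 hu.2
  refine sum_pos' (fun _ _ => by positivity) ⟨n, right_mem_Icc.2 h, ?_⟩
  rw [Nat.choose_self, Nat.sub_self, pow_zero]
  positivity

lemma G_one {m n : ℕ} (h : m ≤ n) : G m n 1 = 1 := by
  rw [G, sum_eq_single_of_mem n (right_mem_Icc.2 h)]
  · simp
  · intro j hj hne
    have : n - j ≠ 0 := Nat.sub_ne_zero_of_lt ((mem_Icc.1 hj).2.lt_of_ne hne)
    rw [sub_self, zero_pow this, mul_zero]

lemma continuous_Gtilde (k n : ℕ) : Continuous (Gtilde k n) := by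
  unfold Gtilde G
  fun_prop

lemma Gtilde_zero (k n : ℕ) : Gtilde k n 0 = 0 := zero_mul _

lemma Gtilde_one {k n : ℕ} (hkn : k ≤ n) : Gtilde k n 1 = 1 := by
  rw [Gtilde, one_mul, G_one (Nat.sub_le_sub_right hkn 1)]

lemma Gtilde_pos {k n : ℕ} (hkn : k ≤ n) {t : ℝ} (ht : t ∈ Set.Ioc (0 : ℝ) 1) :
    0 < Gtilde k n t :=
  mul_pos ht.1 (G_pos (Nat.sub_le_sub_right hkn 1) ht)

lemma Gtilde_nonneg (k n : ℕ) {t : ℝ} (ht : t ∈ Set.Icc (0 : ℝ) 1) : 0 ≤ Gtilde k n t :=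
  mul_nonneg ht.1 (G_nonneg _ _ ht)

lemma Gtilde_monotoneOn (k n : ℕ) : MonotoneOn (Gtilde k n) (Set.Icc 0 1) := fun _ hx _ hy hxy =>
  mul_le_mul hxy (G_monotoneOn _ _ hx hy hxy) (G_nonneg _ _ hx) hy.1

lemma Gtilde_monotone_right (k : ℕ) {t : ℝ} (ht : t ∈ Set.Icc (0 : ℝ) 1) :
    Monotone fun n => Gtilde k n t := fun _ _ h =>
  mul_le_mul_of_nonneg_left (G_monotone_right _ ht (Nat.sub_le_sub_right h 1)) ht.1

lemma GtildeInv_mem_Ioo_and_Gtilde_eq {k n : ℕ} (hkn : k ≤ n) {y : ℝ}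
    (hy : y ∈ Set.Ioo (0 : ℝ) 1) :
    GtildeInv k n y ∈ Set.Ioo (0 : ℝ) 1 ∧ Gtilde k n (GtildeInv k n y) = y := by
  have hex : y ∈ Gtilde k n '' Set.Ioo 0 1 := by
    refine intermediate_value_Ioo zero_le_one (continuous_Gtilde k n).continuousOn ?_
    rwa [Gtilde_zero, Gtilde_one hkn]
  rw [GtildeInv, if_pos hy.2]
  exact ⟨Function.invFunOn_mem hex, Function.invFunOn_eq hex⟩

/-- The inverse of `Gtilde k n` capped at `1`: the critical value `crit` in units of `lam`. -/
noncomputable def cappedInv (k n : ℕ) (y : ℝ) : ℝ := min (GtildeInv k n y) 1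

lemma cappedInv_of_one_le (k n : ℕ) {y : ℝ} (h : 1 ≤ y) : cappedInv k n y = 1 := by
  rw [cappedInv, GtildeInv, if_neg h.not_gt, min_eq_right h]

lemma cappedInv_of_lt_one {k n : ℕ} (hkn : k ≤ n) {y : ℝ} (hy : y ∈ Set.Ioo (0 : ℝ) 1) :
    cappedInv k n y = GtildeInv k n y :=
  min_eq_left (GtildeInv_mem_Ioo_and_Gtilde_eq hkn hy).1.2.le

lemma cappedInv_mem_Ioc {k n : ℕ} (hkn : k ≤ n) {y : ℝ} (hy : 0 < y) :
    cappedInv k n y ∈ Set.Ioc (0 : ℝ) 1 := by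
  refine ⟨?_, min_le_right _ _⟩
  rcases lt_or_ge y 1 with h | h
  · rw [cappedInv_of_lt_one hkn ⟨hy, h⟩]
    exact (GtildeInv_mem_Ioo_and_Gtilde_eq hkn ⟨hy, h⟩).1.1
  · rw [cappedInv_of_one_le k n h]
    exact one_pos

lemma Gtilde_cappedInv_le {k n : ℕ} (hkn : k ≤ n) {y : ℝ} (hy : 0 < y) :
    Gtilde k n (cappedInv k n y) ≤ y := by
  rcases lt_or_ge y 1 with h | h
  · rw [cappedInv_of_lt_one hkn ⟨hy, h⟩]
    exact (GtildeInv_mem_Ioo_and_Gtilde_eq hkn ⟨hy, h⟩).2.le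
  · rwa [cappedInv_of_one_le k n h, Gtilde_one hkn]

lemma cappedInv_monotoneOn {k n : ℕ} (hkn : k ≤ n) :
    MonotoneOn (cappedInv k n) (Set.Ioi 0) := by
  intro y (hy : 0 < y) z (hz : 0 < z) hyz
  rcases lt_or_ge z 1 with hz1 | hz1
  · have hy1 := hyz.trans_lt hz1
    rw [cappedInv_of_lt_one hkn ⟨hy, hy1⟩, cappedInv_of_lt_one hkn ⟨hz, hz1⟩]
    obtain ⟨hy', ey⟩ := GtildeInv_mem_Ioo_and_Gtilde_eq hkn ⟨hy, hy1⟩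
    obtain ⟨hz', ez⟩ := GtildeInv_mem_Ioo_and_Gtilde_eq hkn ⟨hz, hz1⟩
    rcases hyz.eq_or_lt with rfl | hlt
    · exact le_rfl
    · refine ((Gtilde_monotoneOn k n).reflect_lt (Set.Ioo_subset_Icc_self hy')
        (Set.Ioo_subset_Icc_self hz') ?_).le
      rwa [ey, ez]
  · rw [cappedInv_of_one_le k n hz1]
    exact min_le_right _ _

/-! ### The truncated count and its binomial means -/

/-- The numerator `v 1(v ≥ k)` of the `k`-FDP. -/
noncomputable def truncCount (k v : ℕ) : ℝ := if k ≤ v then v else 0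

lemma truncCount_zero (k : ℕ) : truncCount k 0 = 0 := by simp [truncCount]

lemma truncCount_nonneg (k v : ℕ) : 0 ≤ truncCount k v := by
  unfold truncCount
  split_ifs <;> positivity

lemma truncCount_le (k v : ℕ) : truncCount k v ≤ v := by
  unfold truncCount
  split_ifs
  exacts [le_rfl, v.cast_nonneg]

lemma sum_choose_mul_truncCount (k v : ℕ) (u : ℝ) :
    ∑ i ∈ range (v + 1), (v.choose i : ℝ) * (truncCount k i * (u ^ i * (1 - u) ^ (v - i)))
      = v * Gtilde k v u := by
  cases v with
  | zero => simp [truncCount]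
  | succ v =>
    rw [sum_range_succ', truncCount_zero, zero_mul, mul_zero, add_zero, Gtilde,
      Nat.add_sub_cancel, G_eq_sum_range, mul_sum, mul_sum]
    refine sum_congr rfl fun i _ => ?_
    have absorption : ((v + 1).choose (i + 1) : ℝ) * (i + 1) = (v + 1) * v.choose i := by
      exact_mod_cast (Nat.add_one_mul_choose_eq v i).symm
    rw [Nat.add_sub_add_right, truncCount]
    simp only [← tsub_le_iff_right]
    split_ifs
    · push_cast
      linear_combination (u ^ (i + 1) * (1 - u) ^ (v - i)) * absorption
    · simp

lemma sum_powerset_truncCount {ι : Type*} (k : ℕ) (S : Finset ι) (u : ℝ) :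
    ∑ T ∈ S.powerset, truncCount k #T * (u ^ #T * (1 - u) ^ (#S - #T))
      = #S * Gtilde k #S u := by
  rw [sum_powerset_apply_card (fun m => truncCount k m * (u ^ m * (1 - u) ^ (#S - m))),
    ← sum_choose_mul_truncCount]
  simp only [nsmul_eq_mul]

lemma Gtilde_of_lt {k v : ℕ} (hv : v ≠ 0) (hvk : v < k) (u : ℝ) : Gtilde k v u = 0 := by
  rw [Gtilde, G_of_lt (by omega), mul_zero]

lemma truncCount_mul_mean_le (k : ℕ) {u : ℝ} (hu : u ∈ Set.Icc (0 : ℝ) 1) {v v' : ℕ}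
    (h : v ≤ v') :
    truncCount k v' * (v * Gtilde k v u) ≤ truncCount k v * (v' * Gtilde k v' u) := by
  rcases lt_or_ge v k with hv | hv
  · rcases eq_or_ne v 0 with rfl | h0
    · simp [truncCount]
    · simp [Gtilde_of_lt h0 hv, truncCount, hv.not_ge]
  · rw [truncCount, truncCount, if_pos hv, if_pos (hv.trans h)]
    have := mul_le_mul_of_nonneg_left (Gtilde_monotone_right k hu h)
      (show 0 ≤ (v : ℝ) * v' by positivity)
    linarith

/-! ### Averages over the subsets of a given size -/

lemma sum_mul_sum_le_of_monotone_ratio {κ : Type*} [LinearOrder κ] {s : Finset κ}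
    {f g a : κ → ℝ} (hf : ∀ x ∈ s, 0 ≤ f x) (hg : ∀ x ∈ s, 0 ≤ g x) (ha : ∀ x ∈ s, 0 ≤ a x)
    (hfg : ∀ x ∈ s, ∀ y ∈ s, x ≤ y → f y * g x ≤ f x * g y) (hmono : MonotoneOn a s) :
    (∑ x ∈ s, f x * a x) * ∑ x ∈ s, g x ≤ (∑ x ∈ s, f x) * ∑ x ∈ s, g x * a x := by
  have four := four_functions_theorem_univ (α := s) (β := ℝ) (fun x => f x * a x) (fun x => g x)
    (fun x => f x) (fun x => g x * a x) (fun x => mul_nonneg (hf x x.2) (ha x x.2))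
    (fun x => hg x x.2) (fun x => hf x x.2) (fun x => mul_nonneg (hg x x.2) (ha x x.2))
    fun x y => ?_
  · simpa only [univ_eq_attach, sum_attach s f, sum_attach s g, sum_attach s fun x => f x * a x,
      sum_attach s fun x => g x * a x] using four
  · rcases le_total x y with h | h
    · rw [inf_of_le_left h, sup_of_le_right h, mul_assoc, mul_comm (g y)]
      exact mul_le_mul_of_nonneg_left (mul_le_mul_of_nonneg_right (hmono x.2 y.2 h) (hg y y.2))
        (hf x x.2)
    · rw [inf_of_le_right h, sup_of_le_left h, mul_right_comm, ← mul_assoc]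
      exact mul_le_mul_of_nonneg_right (hfg y y.2 x x.2 h) (ha x x.2)

section SubsetAverages

variable {ι : Type*}

/-- The average of a set function `q` over the `v`-element subsets of `N`. -/
noncomputable def layerAverage (N : Finset ι) (q : Finset ι → ℝ) (v : ℕ) : ℝ :=
  (∑ S ∈ N.powersetCard v, q S) / (#N).choose v

lemma layerAverage_nonneg {N : Finset ι} {q : Finset ι → ℝ} (hq : ∀ S, 0 ≤ q S) (v : ℕ) :
    0 ≤ layerAverage N q v :=
  div_nonneg (sum_nonneg fun S _ => hq S) (Nat.cast_nonneg _)

lemma sum_powerset_card_mul (N : Finset ι) (f : ℕ → ℝ) (q : Finset ι → ℝ) :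
    ∑ S ∈ N.powerset, f #S * q S
      = ∑ v ∈ range (#N + 1), (#N).choose v * f v * layerAverage N q v := by
  rw [sum_powerset]
  refine sum_congr rfl fun v hv => ?_
  have hchoose : ((#N).choose v : ℝ) ≠ 0 :=
    Nat.cast_ne_zero.2 (Nat.choose_pos (Nat.lt_succ_iff.1 (mem_range.1 hv))).ne'
  rw [layerAverage, mul_comm _ (f v), mul_assoc, mul_div_cancel₀ _ hchoose, mul_sum]
  exact sum_congr rfl fun S hS => by rw [(mem_powersetCard.1 hS).2]

variable [DecidableEq ι]

lemma sum_powersetCard_sum_insert (N : Finset ι) (q : Finset ι → ℝ) (v : ℕ) :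
    ∑ S ∈ N.powersetCard v, ∑ i ∈ N \ S, q (insert i S)
      = (v + 1) * ∑ S ∈ N.powersetCard (v + 1), q S := by
  have hcount : (v + 1) * ∑ S ∈ N.powersetCard (v + 1), q S
      = ∑ S ∈ N.powersetCard (v + 1), ∑ _i ∈ S, q S := by
    rw [mul_sum]
    refine sum_congr rfl fun S hS => ?_
    rw [sum_const, (mem_powersetCard.1 hS).2, nsmul_eq_mul, Nat.cast_succ]
  rw [hcount, sum_sigma', sum_sigma']
  refine sum_bij' (fun x _ => ⟨insert x.2 x.1, x.2⟩) (fun x _ => ⟨x.1.erase x.2, x.2⟩)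
    ?_ ?_ ?_ ?_ fun _ _ => rfl <;> rintro ⟨S, i⟩ h <;>
    simp only [mem_sigma, mem_powersetCard, mem_sdiff] at h ⊢
  · exact ⟨⟨insert_subset h.2.1 h.1.1, by rw [card_insert_of_notMem h.2.2, h.1.2]⟩,
      mem_insert_self _ _⟩
  · exact ⟨⟨(erase_subset _ _).trans h.1.1, by rw [card_erase_of_mem h.2, h.1.2]; rfl⟩,
      h.1.1 h.2, notMem_erase _ _⟩
  · rw [erase_insert h.2.2]
  · rw [insert_erase h.2]

lemma layerAverage_monotoneOn {N : Finset ι} {q : Finset ι → ℝ}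
    (hq : ∀ S ⊆ N, ∀ i ∈ N \ S, q S ≤ q (insert i S)) :
    MonotoneOn (layerAverage N q) (Set.Iic #N) := by
  refine monotoneOn_of_le_add_one Set.ordConnected_Iic fun v _ _ hv => ?_
  have hv : v < #N := hv
  have hsum : ((#N : ℝ) - v) * ∑ S ∈ N.powersetCard v, q S
      ≤ (v + 1) * ∑ S ∈ N.powersetCard (v + 1), q S := by
    rw [← sum_powersetCard_sum_insert, mul_sum]
    refine sum_le_sum fun S hS => ?_
    obtain ⟨hSN, hcard⟩ := mem_powersetCard.1 hS
    rw [← Nat.cast_sub hv.le, ← hcard, ← card_sdiff_of_subset hSN, ← nsmul_eq_mul]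
    exact card_nsmul_le_sum _ _ _ fun i hi => hq S hSN i hi
  have hchoose : ((#N).choose (v + 1) : ℝ) * (v + 1) = (#N).choose v * (#N - v) := by
    rw [← Nat.cast_sub hv.le]
    exact_mod_cast Nat.choose_succ_right_eq _ v
  have hpos : 0 < ((#N).choose v : ℝ) := by exact_mod_cast Nat.choose_pos hv.le
  have hpos' : 0 < ((#N).choose (v + 1) : ℝ) := by exact_mod_cast Nat.choose_pos hv
  rw [layerAverage, layerAverage, div_le_div_iff₀ hpos hpos']
  refine le_of_mul_le_mul_right ?_ (show (0 : ℝ) < v + 1 by positivity)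
  rw [mul_assoc, hchoose]
  linarith [mul_le_mul_of_nonneg_left hsum hpos.le]

lemma sum_powerset_mul_sum_le {N : Finset ι} {f g : ℕ → ℝ} {q : Finset ι → ℝ}
    (hf : ∀ v, 0 ≤ f v) (hg : ∀ v, 0 ≤ g v) (hfg : ∀ v v', v ≤ v' → f v' * g v ≤ f v * g v')
    (hq : ∀ S, 0 ≤ q S) (hmono : ∀ S ⊆ N, ∀ i ∈ N \ S, q S ≤ q (insert i S)) :
    (∑ S ∈ N.powerset, f #S * q S) * ∑ S ∈ N.powerset, g #S
      ≤ (∑ S ∈ N.powerset, f #S) * ∑ S ∈ N.powerset, g #S * q S := by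
  rw [sum_powerset_card_mul, sum_powerset_card_mul, sum_powerset_apply_card,
    sum_powerset_apply_card]
  simp only [nsmul_eq_mul]
  refine sum_mul_sum_le_of_monotone_ratio
    (fun v _ => mul_nonneg (Nat.cast_nonneg _) (hf v))
    (fun v _ => mul_nonneg (Nat.cast_nonneg _) (hg v)) (fun v _ => layerAverage_nonneg hq v)
    (fun v _ v' _ h => ?_)
    ((layerAverage_monotoneOn hmono).mono fun v hv => Nat.lt_succ_iff.1 (mem_range.1 hv))
  rw [mul_mul_mul_comm, mul_mul_mul_comm ((#N).choose v : ℝ),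
    mul_comm ((#N).choose v' : ℝ)]
  exact mul_le_mul_of_nonneg_left (hfg v v' h) (by positivity)

end SubsetAverages

/-! ### Coordinates below a level -/

section Below

variable {ι : Type*}

/-- The indices in `N` whose coordinate of `x` is at most `t`. For a vector of p-values these are
the hypotheses in `N` that are rejected at level `t`. -/
noncomputable def below (N : Finset ι) (t : ℝ) (x : ι → ℝ) : Finset ι := {i ∈ N | x i ≤ t}

@[simp]
lemma mem_below {N : Finset ι} {t : ℝ} {x : ι → ℝ} {i : ι} :
    i ∈ below N t x ↔ i ∈ N ∧ x i ≤ t := mem_filter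

lemma below_subset (N : Finset ι) (t : ℝ) (x : ι → ℝ) : below N t x ⊆ N := filter_subset _ _

lemma below_subset_below (N : Finset ι) {s t : ℝ} (h : s ≤ t) (x : ι → ℝ) :
    below N s x ⊆ below N t x := monotone_filter_right _ fun _ _ hx => hx.trans h

/-- Events about a vector of p-values that persist when coordinates are lowered, and also when
coordinates are moved within `(-∞, b]`. -/
def StableBelow (b : ℝ) (A : Set (ι → ℝ)) : Prop :=
  ∀ ⦃x y : ι → ℝ⦄, x ∈ A → y ≤ x ⊔ (fun _ => b) → y ∈ A

lemma stableBelow_univ (b : ℝ) : StableBelow b (Set.univ : Set (ι → ℝ)) :=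
  fun _ _ _ _ => Set.mem_univ _

/-- The event that `A` occurs and exactly the coordinates in `S`, among those in `N`, are at most
`b`. -/
def cell (A : Set (ι → ℝ)) (N : Finset ι) (b : ℝ) (S : Finset ι) : Set (ι → ℝ) :=
  {x | x ∈ A ∧ below N b x = S}

variable {N S : Finset ι} {b : ℝ} {x : ι → ℝ} {A : Set (ι → ℝ)}

lemma le_of_mem_cell (hx : x ∈ cell A N b S) {i : ι} (hi : i ∈ S) : x i ≤ b := by
  rw [← hx.2] at hi
  exact (mem_below.1 hi).2

variable [DecidableEq ι]

lemma below_piecewise (hx : ∀ i ∈ S, x i ≤ b) :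
    below N b (S.piecewise (fun _ => b) x) = below N b x := by
  ext i
  by_cases hi : i ∈ S
  · simp [hi, hx i hi]
  · simp [hi]

lemma StableBelow.piecewise_mem (hA : StableBelow b A) (hx : x ∈ A) :
    S.piecewise (fun _ => b) x ∈ A :=
  hA hx (piecewise_le_of_le_of_le _ le_sup_right le_sup_left)

lemma StableBelow.piecewise_mem_iff (hA : StableBelow b A) (hx : ∀ i ∈ S, x i ≤ b) :
    S.piecewise (fun _ => b) x ∈ A ↔ x ∈ A := by
  refine ⟨fun h => hA h fun i => ?_, hA.piecewise_mem⟩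
  by_cases hi : i ∈ S
  · simp [hi, hx i hi]
  · simp [hi]

lemma StableBelow.piecewise_mem_cell_iff (hA : StableBelow b A) {T : Finset ι}
    (hx : ∀ i ∈ S, x i ≤ b) :
    S.piecewise (fun _ => b) x ∈ cell A N b T ↔ x ∈ cell A N b T := by
  rw [cell, Set.mem_ofPred_eq, Set.mem_ofPred_eq, hA.piecewise_mem_iff hx, below_piecewise hx]

lemma StableBelow.mem_cell_iff (hA : StableBelow b A) :
    x ∈ cell A N b S ↔ (∀ i ∈ S, x i ≤ b) ∧ S.piecewise (fun _ => b) x ∈ cell A N b S := by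
  refine ⟨fun hx => ?_, fun ⟨hle, hx⟩ => (hA.piecewise_mem_cell_iff hle).1 hx⟩
  have hle : ∀ i ∈ S, x i ≤ b := fun i hi => le_of_mem_cell hx hi
  exact ⟨hle, (hA.piecewise_mem_cell_iff hle).2 hx⟩

lemma StableBelow.piecewise_singleton_mem_cell_insert (hA : StableBelow b A) {i : ι} (hi : i ∈ N)
    (hx : x ∈ cell A N b S) :
    ({i} : Finset ι).piecewise (fun _ => b) x ∈ cell A N b (insert i S) := by
  refine ⟨hA.piecewise_mem hx.1, ?_⟩
  rw [← hx.2]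
  ext j
  by_cases hj : j = i
  · simp [hj, hi]
  · simp [hj]

end Below

/-! ### Independent p-values -/

section Independence

variable {Ω ι : Type*} [MeasurableSpace Ω] {μ : Measure Ω}

lemma integral_eq_sum_setIntegral_fiber {β : Type*} {F : Ω → β} {s : Finset β}
    (hs : ∀ ω, F ω ∈ s) (hF : ∀ b ∈ s, MeasurableSet (F ⁻¹' {b})) {u : Ω → ℝ}
    (hu : Integrable u μ) :
    ∫ ω, u ω ∂μ = ∑ b ∈ s, ∫ ω in F ⁻¹' {b}, u ω ∂μ := by
  have hcover : ⋃ b ∈ s, F ⁻¹' {b} = Set.univ :=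
    Set.eq_univ_of_forall fun ω => Set.mem_biUnion (hs ω) rfl
  rw [← setIntegral_univ, ← hcover]
  refine integral_biUnion_finset s hF (fun b _ c _ hbc => ?_) fun _ _ => hu.integrableOn
  exact (Set.disjoint_singleton.2 hbc).preimage F

lemma measureReal_forall_mem_and_piecewise_mem [DecidableEq ι] [Finite ι] {X : Ω → ι → ℝ}
    (hX : Measurable X) (hindep : iIndepFun (fun i ω => X ω i) μ) (S : Finset ι) {Z : ι → Set ℝ}
    (hZ : ∀ i, MeasurableSet (Z i)) (c : ι → ℝ) {B : Set (ι → ℝ)} (hB : MeasurableSet B) :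
    μ.real {ω | (∀ i ∈ S, X ω i ∈ Z i) ∧ S.piecewise c (X ω) ∈ B}
      = (∏ i ∈ S, μ.real {ω | X ω i ∈ Z i}) * μ.real {ω | S.piecewise c (X ω) ∈ B} := by
  have := Fintype.ofFinite ι
  set fill : ((Sᶜ : Finset ι) → ℝ) → ι → ℝ :=
    fun z i => if h : i ∈ Sᶜ then z ⟨i, h⟩ else c i with hfill
  have hfill_meas : Measurable fill := measurable_pi_lambda _ fun i => by
    by_cases h : i ∈ Sᶜ
    · simpa only [hfill, h, dif_pos] using measurable_pi_apply _
    · simpa only [hfill, h, dif_neg, not_false_eq_true] using measurable_const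
  have hfill_eq : ∀ ω, fill (fun i => X ω i) = S.piecewise c (X ω) := fun ω => by
    ext i
    by_cases h : i ∈ S <;> simp [hfill, h]
  have hind := hindep.indepFun_finset S Sᶜ disjoint_compl_right
    fun i => (measurable_pi_apply i).comp hX
  have hbox : (fun ω (i : S) => X ω i) ⁻¹' (Set.univ.pi fun i : S => Z i)
      = ⋂ i ∈ S, (fun ω => X ω i) ⁻¹' Z i := by
    ext ω
    simp
  have hrest : (fun ω (i : (Sᶜ : Finset ι)) => X ω i) ⁻¹' (fill ⁻¹' B)
      = {ω | S.piecewise c (X ω) ∈ B} := by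
    ext ω
    simp [hfill_eq]
  have hevent : {ω | (∀ i ∈ S, X ω i ∈ Z i) ∧ S.piecewise c (X ω) ∈ B}
      = (⋂ i ∈ S, (fun ω => X ω i) ⁻¹' Z i) ∩ {ω | S.piecewise c (X ω) ∈ B} := by
    ext ω
    simp
  have hsplit := hind.measure_inter_preimage_eq_mul _ _
    (MeasurableSet.univ_pi fun i : S => hZ i) (hfill_meas hB)
  rw [hbox, hrest] at hsplit
  rw [hevent, measureReal_def, hsplit, hindep.measure_inter_preimage_eq_mul S fun i _ => hZ i,
    ENNReal.toReal_mul, ENNReal.toReal_prod]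
  rfl

end Independence

section Below

variable {Ω ι : Type*} [MeasurableSpace Ω]

lemma measurable_below {X : Ω → ι → ℝ} (hX : Measurable X) (N : Finset ι) {t : Ω → ℝ}
    (ht : Measurable t) : Measurable fun ω => below N (t ω) (X ω) := by
  refine measurable_finset_iff.2 fun i => measurableSet_setOfPred.1 ?_
  simp only [mem_below]
  exact MeasurableSet.inter (.const _) (measurableSet_le ((measurable_pi_apply i).comp hX) ht)

lemma measurableSet_cell [Countable ι] {A : Set (ι → ℝ)} (hA : MeasurableSet A) (N : Finset ι)
    (b : ℝ) (S : Finset ι) : MeasurableSet (cell A N b S) :=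
  hA.inter (measurable_below measurable_id N measurable_const (measurableSet_singleton S))

end Below

lemma cell_cell_iff {ι : Type*} [DecidableEq ι] {A : Set (ι → ℝ)} {N S T : Finset ι} {a b : ℝ}
    (hA : StableBelow b A) (hab : a ≤ b) (hTS : T ⊆ S) (hSN : S ⊆ N) {x : ι → ℝ} :
    x ∈ cell (cell A N b S) N a T ↔
      (∀ i ∈ S, x i ∈ if i ∈ T then Set.Iic a else Set.Ioc a b) ∧
        S.piecewise (fun _ => b) x ∈ cell A N b S := by
  have hlevel (i : ι) (h : x i ∈ if i ∈ T then Set.Iic a else Set.Ioc a b) :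
      x i ≤ b ∧ (x i ≤ a ↔ i ∈ T) := by
    split_ifs at h with hi
    · exact ⟨le_trans h hab, iff_of_true h hi⟩
    · exact ⟨h.2, iff_of_false h.1.not_ge hi⟩
  constructor
  · rintro ⟨hx, hT⟩
    refine ⟨fun i hi => ?_, (hA.mem_cell_iff.1 hx).2⟩
    have hiT : i ∈ T ↔ x i ≤ a := by rw [← hT, mem_below, and_iff_right (hSN hi)]
    split_ifs with h
    · exact hiT.1 h
    · exact ⟨not_le.1 (mt hiT.2 h), le_of_mem_cell hx hi⟩
  · rintro ⟨hZ, hx⟩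
    have hcell : x ∈ cell A N b S := hA.mem_cell_iff.2 ⟨fun i hi => (hlevel i (hZ i hi)).1, hx⟩
    refine ⟨hcell, Subset.antisymm (fun i hi => ?_) fun i hi => ?_⟩
    · have hiS : i ∈ S := by
        rw [← hcell.2]
        exact below_subset_below N hab x hi
      exact (hlevel i (hZ i hiS)).2.1 (mem_below.1 hi).2
    · exact mem_below.2 ⟨hSN (hTS hi), (hlevel i (hZ i (hTS hi))).2.2 hi⟩

lemma prod_ite_mem_const {ι : Type*} [DecidableEq ι] {S T : Finset ι} (hTS : T ⊆ S) (u v : ℝ) :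
    ∏ i ∈ S, (if i ∈ T then u else v) = u ^ #T * v ^ (#S - #T) := by
  rw [← prod_sdiff hTS, prod_congr rfl fun i hi => if_neg (mem_sdiff.1 hi).2,
    prod_congr rfl fun i hi => if_pos hi, prod_const, prod_const, card_sdiff_of_subset hTS,
    mul_comm]

/-- A vector `X` of independent p-values for which the hypotheses in `N` are true null hypotheses,
so that their p-values are uniform; only the values up to `lam` of the distribution function
matter. -/
structure PValues {Ω ι : Type*} [MeasurableSpace Ω] (X : Ω → ι → ℝ) (N : Finset ι)
    (μ : Measure Ω) (lam : ℝ) : Prop where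
  measurable : Measurable X
  indep : iIndepFun (fun i ω => X ω i) μ
  measureReal_le : ∀ i ∈ N, ∀ t ∈ Set.Icc 0 lam, μ.real {ω | X ω i ≤ t} = t

namespace PValues

variable {Ω ι : Type*} [MeasurableSpace Ω] {μ : Measure Ω} {X : Ω → ι → ℝ}
  {N S T : Finset ι} {lam a b : ℝ} {A : Set (ι → ℝ)} {i : ι}

lemma measurable_apply (h : PValues X N μ lam) (i : ι) : Measurable fun ω => X ω i :=
  (measurable_pi_apply i).comp h.measurable

lemma indep_prodMk (h : PValues X N μ lam) : iIndepFun (fun i ω => (X ω i, X ω i)) μ :=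
  h.indep.comp (fun _ x => (x, x)) fun _ => measurable_id.prodMk measurable_id

lemma measurableSet_le (h : PValues X N μ lam) (i : ι) (t : ℝ) : MeasurableSet {ω | X ω i ≤ t} :=
  measurableSet_Iic.preimage (h.measurable_apply i)

lemma integrable_comp_card_below [IsFiniteMeasure μ] [Finite ι] (h : PValues X N μ lam) (b : ℝ)
    (w : ℕ → ℝ) : Integrable (fun ω => w #(below N b (X ω))) μ := by
  refine .of_bound (C := ∑ v ∈ range (#N + 1), |w v|)
    ((Measurable.of_discrete (f := fun V : Finset ι => w #V)).comp
      (measurable_below h.measurable N measurable_const)).aestronglyMeasurable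
    (.of_forall fun ω => ?_)
  exact single_le_sum (f := fun v => |w v|) (fun v _ => abs_nonneg _)
    (mem_range.2 (Nat.lt_succ_of_le (card_le_card (below_subset N b (X ω)))))

lemma measurableSet_below_eq [Finite ι] (h : PValues X N μ lam) (b : ℝ) (S : Finset ι) :
    MeasurableSet ((fun ω => below N b (X ω)) ⁻¹' {S}) :=
  measurable_below h.measurable N measurable_const (measurableSet_singleton S)

lemma setIntegral_eq_sum_cell [Finite ι] (h : PValues X N μ lam) (b : ℝ) {u : Ω → ℝ}
    (hu : Integrable u μ) :
    ∫ ω in X ⁻¹' A, u ω ∂μ = ∑ S ∈ N.powerset, ∫ ω in X ⁻¹' cell A N b S, u ω ∂μ := by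
  rw [integral_eq_sum_setIntegral_fiber (F := fun ω => below N b (X ω))
    (fun ω => mem_powerset.2 (below_subset N b (X ω)))
    (fun S _ => h.measurableSet_below_eq b S) hu.integrableOn]
  refine sum_congr rfl fun S _ => ?_
  rw [Measure.restrict_restrict (h.measurableSet_below_eq b S), Set.inter_comm]
  rfl

variable [IsProbabilityMeasure μ]

lemma measureReal_Ioc (h : PValues X N μ lam) (hi : i ∈ N) (ha : 0 ≤ a) (hab : a ≤ b)
    (hb : b ≤ lam) : μ.real {ω | X ω i ∈ Set.Ioc a b} = b - a := by
  have hdiff : {ω | X ω i ∈ Set.Ioc a b} = {ω | X ω i ≤ b} \ {ω | X ω i ≤ a} := by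
    ext ω
    simp [and_comm]
  have hsub : {ω | X ω i ≤ a} ⊆ {ω | X ω i ≤ b} := fun ω hω => le_trans hω hab
  rw [hdiff, measureReal_sdiff hsub (h.measurableSet_le i a),
    h.measureReal_le i hi b ⟨ha.trans hab, hb⟩, h.measureReal_le i hi a ⟨ha, hab.trans hb⟩]

lemma measureReal_Ioi (h : PValues X N μ lam) (hi : i ∈ N) (hb : b ∈ Set.Icc 0 lam) :
    μ.real {ω | X ω i ∈ Set.Ioi b} = 1 - b := by
  have hcompl : {ω | X ω i ∈ Set.Ioi b} = {ω | X ω i ≤ b}ᶜ := by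
    ext ω
    simp
  rw [hcompl, probReal_compl_eq_one_sub (h.measurableSet_le i b),
    h.measureReal_le i hi b hb]

variable [Finite ι]

lemma setIntegral_comp_card_below (h : PValues X N μ lam) (hA : MeasurableSet A) (b : ℝ)
    (w : ℕ → ℝ) :
    ∫ ω in X ⁻¹' A, w #(below N b (X ω)) ∂μ
      = ∑ S ∈ N.powerset, μ.real (X ⁻¹' cell A N b S) * w #S := by
  rw [h.setIntegral_eq_sum_cell b (h.integrable_comp_card_below b w)]
  refine sum_congr rfl fun S _ => ?_
  rw [setIntegral_congr_fun (g := fun _ => w #S) (h.measurable (measurableSet_cell hA N b S))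
    fun ω hω => by simp only [hω.2], setIntegral_const, smul_eq_mul]

lemma measureReal_cell_univ (h : PValues X N μ lam) (hb : b ∈ Set.Icc 0 lam) (hS : S ⊆ N) :
    μ.real (X ⁻¹' cell Set.univ N b S) = b ^ #S * (1 - b) ^ (#N - #S) := by
  classical
  have hevent : X ⁻¹' cell Set.univ N b S
      = {ω | (∀ i ∈ N, X ω i ∈ if i ∈ S then Set.Iic b else Set.Ioi b) ∧
          N.piecewise (fun _ => b) (X ω) ∈ Set.univ} := by
    ext ω
    simp only [Set.mem_preimage, cell, Finset.ext_iff, mem_below, Set.mem_ofPred_eq, Set.mem_univ,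
      true_and, and_true]
    refine forall_congr' fun i => ?_
    by_cases hi : i ∈ S
    · simp [hi, hS hi]
    · simp [hi]
  rw [hevent, measureReal_forall_mem_and_piecewise_mem h.measurable h.indep N
    (fun i => by split_ifs <;> measurability) _ .univ, ← prod_ite_mem_const hS]
  simp only [Set.mem_univ, Set.ofPred_true, probReal_univ, mul_one]
  refine prod_congr rfl fun i hi => ?_
  split_ifs
  · exact h.measureReal_le i hi b hb
  · exact h.measureReal_Ioi hi hb

section Piecewise

variable [DecidableEq ι]

lemma measureReal_cell_cell (h : PValues X N μ lam) (ha : 0 ≤ a) (hab : a ≤ b) (hb : b ≤ lam)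
    (hA : MeasurableSet A) (hAb : StableBelow b A) (hTS : T ⊆ S) (hSN : S ⊆ N) :
    μ.real (X ⁻¹' cell (cell A N b S) N a T)
      = a ^ #T * (b - a) ^ (#S - #T)
          * μ.real {ω | S.piecewise (fun _ => b) (X ω) ∈ cell A N b S} := by
  have hevent : X ⁻¹' cell (cell A N b S) N a T
      = {ω | (∀ i ∈ S, X ω i ∈ if i ∈ T then Set.Iic a else Set.Ioc a b) ∧
          S.piecewise (fun _ => b) (X ω) ∈ cell A N b S} :=
    Set.ext fun ω => cell_cell_iff hAb hab hTS hSN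
  rw [hevent, measureReal_forall_mem_and_piecewise_mem h.measurable h.indep S
    (fun i => by split_ifs <;> measurability) _ (measurableSet_cell hA N b S),
    ← prod_ite_mem_const hTS]
  congr 1
  refine prod_congr rfl fun i hi => ?_
  split_ifs
  · exact h.measureReal_le i (hSN hi) a ⟨ha, hab.trans hb⟩
  · exact h.measureReal_Ioc (hSN hi) ha hab hb

lemma measureReal_cell (h : PValues X N μ lam) (hb : b ∈ Set.Icc 0 lam) (hA : MeasurableSet A)
    (hAb : StableBelow b A) (hS : S ⊆ N) :
    μ.real (X ⁻¹' cell A N b S)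
      = b ^ #S * μ.real {ω | S.piecewise (fun _ => b) (X ω) ∈ cell A N b S} := by
  have hcell : cell (cell A N b S) N b S = cell A N b S :=
    Set.inter_eq_left.2 fun x hx => hx.2
  rw [← hcell, h.measureReal_cell_cell hb.1 le_rfl hb.2 hA hAb Subset.rfl hS, hcell,
    Nat.sub_self, pow_zero, mul_one]

lemma mul_measureReal_cell_le (h : PValues X N μ lam) (hb : b ∈ Set.Icc 0 lam)
    (hA : MeasurableSet A) (hAb : StableBelow b A) (hi : i ∈ N \ S) :
    b * μ.real (X ⁻¹' cell A N b S) ≤ (1 - b) * μ.real (X ⁻¹' cell A N b (insert i S)) := by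
  obtain ⟨hiN, hiS⟩ := mem_sdiff.1 hi
  set d := μ.real {ω | ({i} : Finset ι).piecewise (fun _ => b) (X ω) ∈ cell A N b (insert i S)}
  have hsplit {Z : Set ℝ} (hZ : MeasurableSet Z) :=
    measureReal_forall_mem_and_piecewise_mem h.measurable h.indep {i} (fun _ => hZ)
      (fun _ => b) (measurableSet_cell hA N b (insert i S))
  simp only [mem_singleton, forall_eq, prod_singleton] at hsplit
  have hlower : b * d ≤ μ.real (X ⁻¹' cell A N b (insert i S)) := by
    have hIic : μ.real {ω | X ω i ∈ Set.Iic b} = b := h.measureReal_le i hiN b hb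
    have hprod := hsplit (measurableSet_Iic (a := b))
    rw [hIic] at hprod
    rw [← hprod]
    refine measureReal_mono fun ω hω => ?_
    exact (hAb.piecewise_mem_cell_iff fun j hj => by rw [mem_singleton.1 hj]; exact hω.1).1 hω.2
  have hupper : μ.real (X ⁻¹' cell A N b S) ≤ (1 - b) * d := by
    rw [← h.measureReal_Ioi hiN hb, ← hsplit measurableSet_Ioi]
    refine measureReal_mono fun ω hω => ⟨Set.mem_Ioi.2 (not_le.1 fun hle => hiS ?_),
      hAb.piecewise_singleton_mem_cell_insert hiN hω⟩
    rw [← hω.2]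
    exact mem_below.2 ⟨hiN, hle⟩
  have hb1 : 0 ≤ 1 - b := by
    rw [← h.measureReal_Ioi hiN hb]
    exact measureReal_nonneg
  calc b * μ.real (X ⁻¹' cell A N b S) ≤ b * ((1 - b) * d) :=
        mul_le_mul_of_nonneg_left hupper hb.1
    _ = (1 - b) * (b * d) := mul_left_comm _ _ _
    _ ≤ _ := mul_le_mul_of_nonneg_left hlower hb1

end Piecewise

/-- Given the set `S` of null hypotheses rejected at level `b` and an event that is stable below
`b`, each hypothesis of `S` is rejected at level `a` independently with probability `a / b`. -/
lemma measureReal_cell_cell_eq_mul (h : PValues X N μ lam) (ha : 0 ≤ a) (hab : a ≤ b)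
    (hb : b ∈ Set.Ioc 0 lam) (hA : MeasurableSet A) (hAb : StableBelow b A) (hTS : T ⊆ S)
    (hSN : S ⊆ N) :
    μ.real (X ⁻¹' cell (cell A N b S) N a T)
      = μ.real (X ⁻¹' cell A N b S) * ((a / b) ^ #T * (1 - a / b) ^ (#S - #T)) := by
  classical
  have hb0 := hb.1.ne'
  rw [h.measureReal_cell_cell ha hab hb.2 hA hAb hTS hSN,
    h.measureReal_cell ⟨hb.1.le, hb.2⟩ hA hAb hSN, one_sub_div hb0, div_pow, div_pow]
  nth_rewrite 2 [← Nat.add_sub_cancel' (card_le_card hTS)]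
  rw [pow_add]
  field_simp

lemma setIntegral_truncCount_cell (h : PValues X N μ lam) (ha : 0 ≤ a) (hab : a ≤ b)
    (hb : b ∈ Set.Ioc 0 lam) (hA : MeasurableSet A) (hAb : StableBelow b A) (hSN : S ⊆ N)
    (k : ℕ) :
    ∫ ω in X ⁻¹' cell A N b S, truncCount k #(below N a (X ω)) ∂μ
      = μ.real (X ⁻¹' cell A N b S) * (#S * Gtilde k #S (a / b)) := by
  rw [h.setIntegral_comp_card_below (measurableSet_cell hA N b S), ← sum_powerset_truncCount,
    mul_sum, ← sum_subset (powerset_mono.2 hSN) fun T _ hT => ?_]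
  · refine sum_congr rfl fun T hT => ?_
    rw [h.measureReal_cell_cell_eq_mul ha hab hb hA hAb (mem_powerset.1 hT) hSN]
    ring
  · have hempty : cell (cell A N b S) N a T = ∅ := Set.eq_empty_of_forall_notMem fun x hx =>
      hT (mem_powerset.2 (hx.2 ▸ hx.1.2 ▸ below_subset_below N hab x))
    rw [hempty, Set.preimage_empty, measureReal_empty, zero_mul]

lemma setIntegral_truncCount (h : PValues X N μ lam) (ha : 0 ≤ a) (hab : a ≤ b)
    (hb : b ∈ Set.Ioc 0 lam) (hA : MeasurableSet A) (hAb : StableBelow b A) (k : ℕ) :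
    ∫ ω in X ⁻¹' A, truncCount k #(below N a (X ω)) ∂μ
      = ∑ S ∈ N.powerset, μ.real (X ⁻¹' cell A N b S) * (#S * Gtilde k #S (a / b)) := by
  rw [h.setIntegral_eq_sum_cell b (h.integrable_comp_card_below a _)]
  exact sum_congr rfl fun S hS =>
    h.setIntegral_truncCount_cell ha hab hb hA hAb (mem_powerset.1 hS) k

lemma integral_comp_card_below (h : PValues X N μ lam) (hb : b ∈ Set.Icc 0 lam) (w : ℕ → ℝ) :
    ∫ ω, w #(below N b (X ω)) ∂μ
      = ∑ S ∈ N.powerset, w #S * (b ^ #S * (1 - b) ^ (#N - #S)) := by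
  rw [← setIntegral_univ, ← Set.preimage_univ (f := X), h.setIntegral_comp_card_below .univ]
  refine sum_congr rfl fun S hS => ?_
  rw [mul_comm, h.measureReal_cell_univ hb (mem_powerset.1 hS)]

lemma integral_truncCount (h : PValues X N μ lam) (hb : b ∈ Set.Icc 0 lam) (k : ℕ) :
    ∫ ω, truncCount k #(below N b (X ω)) ∂μ = #N * Gtilde k #N b := by
  rw [h.integral_comp_card_below hb, sum_powerset_truncCount]

/-- The conditional probability, as a function of `S`, of the event `A` given that exactly the null
hypotheses in `S` are rejected at level `b`. When `b = 1` and `S ≠ N` the condition has probability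
zero, and the value is the junk value `0`. -/
noncomputable def condCell (X : Ω → ι → ℝ) (N : Finset ι) (μ : Measure Ω) (b : ℝ)
    (A : Set (ι → ℝ)) (S : Finset ι) : ℝ :=
  μ.real (X ⁻¹' cell A N b S) / (b ^ #S * (1 - b) ^ (#N - #S))

lemma mul_condCell (h : PValues X N μ lam) (hb : b ∈ Set.Icc 0 lam) (hS : S ⊆ N)
    (A : Set (ι → ℝ)) :
    b ^ #S * (1 - b) ^ (#N - #S) * condCell X N μ b A S = μ.real (X ⁻¹' cell A N b S) := by
  refine mul_div_cancel_of_imp' fun hzero => measureReal_nonneg.antisymm' ?_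
  rw [← hzero, ← h.measureReal_cell_univ hb hS]
  exact measureReal_mono fun ω hω => ⟨Set.mem_univ _, hω.2⟩

lemma condCell_le_condCell_insert [DecidableEq ι] (h : PValues X N μ lam)
    (hb : b ∈ Set.Ioc 0 lam) (hb1 : b ≤ 1) (hA : MeasurableSet A) (hAb : StableBelow b A)
    (hS : S ⊆ N) (hi : i ∈ N \ S) :
    condCell X N μ b A S ≤ condCell X N μ b A (insert i S) := by
  obtain ⟨hiN, hiS⟩ := mem_sdiff.1 hi
  have hcard : #S + 1 ≤ #N := by
    rw [← card_insert_of_notMem hiS]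
    exact card_le_card (insert_subset hiN hS)
  have hexp : #N - #S = (#N - (#S + 1)) + 1 := by omega
  have hstep := h.mul_measureReal_cell_le ⟨hb.1.le, hb.2⟩ hA hAb hi
  rw [condCell, condCell, card_insert_of_notMem hiS, hexp, pow_succ, pow_succ]
  rcases hb1.eq_or_lt with rfl | hlt
  · simp only [sub_self, mul_zero, div_zero]
    exact div_nonneg measureReal_nonneg (by positivity)
  · have hb0 := hb.1
    have : 0 < 1 - b := sub_pos.2 hlt
    rw [div_le_div_iff₀ (by positivity) (by positivity)]
    have hweight : 0 ≤ b ^ #S * (1 - b) ^ (#N - (#S + 1)) := by positivity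
    linear_combination mul_le_mul_of_nonneg_left hstep hweight

/-- The key correlation inequality: conditioning on a larger set of rejections at level `b` makes
`A` more likely, and tilts the law of `#(below N b X)` towards the weights `v * Gtilde k v (a / b)`
of the smaller level. -/
lemma setIntegral_truncCount_mul_le (h : PValues X N μ 1) (ha : 0 ≤ a) (hab : a ≤ b)
    (hb : b ∈ Set.Ioc 0 1) (hA : MeasurableSet A) (hAb : StableBelow b A) (k : ℕ) :
    (∫ ω in X ⁻¹' A, truncCount k #(below N b (X ω)) ∂μ) * (#N * Gtilde k #N a)
      ≤ (∫ ω in X ⁻¹' A, truncCount k #(below N a (X ω)) ∂μ) * (#N * Gtilde k #N b) := by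
  classical
  have hb' : b ∈ Set.Icc 0 1 := ⟨hb.1.le, hb.2⟩
  have hc : a / b ∈ Set.Icc 0 1 := ⟨div_nonneg ha hb'.1, div_le_one_of_le₀ hab hb'.1⟩
  set π : ℕ → ℝ := fun v => b ^ v * (1 - b) ^ (#N - v)
  have hπ (v : ℕ) : 0 ≤ π v := mul_nonneg (pow_nonneg hb'.1 v)
    (pow_nonneg (sub_nonneg.2 hb'.2) _)
  have hexpand (A : Set (ι → ℝ)) (w : ℕ → ℝ) :
      ∑ S ∈ N.powerset, μ.real (X ⁻¹' cell A N b S) * w #S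
        = ∑ S ∈ N.powerset, π #S * w #S * condCell X N μ b A S :=
    sum_congr rfl fun S hS => by
      rw [← h.mul_condCell hb' (mem_powerset.1 hS), mul_right_comm]
  have hmean_b : #N * Gtilde k #N b = ∑ S ∈ N.powerset, π #S * truncCount k #S := by
    rw [← h.integral_truncCount hb', h.integral_comp_card_below hb']
    exact sum_congr rfl fun S _ => mul_comm _ _
  have hmean_a : #N * Gtilde k #N a
      = ∑ S ∈ N.powerset, π #S * (#S * Gtilde k #S (a / b)) := by
    rw [← h.integral_truncCount ⟨ha, hab.trans hb.2⟩, ← setIntegral_univ,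
      ← Set.preimage_univ (f := X), h.setIntegral_truncCount ha hab hb .univ (stableBelow_univ b)]
    exact sum_congr rfl fun S hS => by rw [h.measureReal_cell_univ hb' (mem_powerset.1 hS)]
  rw [h.setIntegral_comp_card_below hA, h.setIntegral_truncCount ha hab hb hA hAb,
    hexpand A (truncCount k), hexpand A fun v => v * Gtilde k v (a / b), hmean_a, hmean_b,
    mul_comm (∑ S ∈ N.powerset, π #S * (_ * _) * _)]
  refine sum_powerset_mul_sum_le (f := fun v => π v * truncCount k v)
    (g := fun v => π v * (v * Gtilde k v (a / b)))
    (fun v => mul_nonneg (hπ v) (truncCount_nonneg k v))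
    (fun v => mul_nonneg (hπ v) (mul_nonneg v.cast_nonneg (Gtilde_nonneg k v hc)))
    (fun v v' hv => ?_) (fun S => div_nonneg measureReal_nonneg (hπ #S))
    fun S hS i hi => h.condCell_le_condCell_insert hb hb.2 hA hAb hS hi
  rw [mul_mul_mul_comm, mul_mul_mul_comm (π v), mul_comm (π v')]
  exact mul_le_mul_of_nonneg_left (truncCount_mul_mean_le k hc hv) (mul_nonneg (hπ v) (hπ v'))

end PValues

/-! ### Step-up procedures -/

section StepUp

variable {ι : Type*} [Fintype ι] {c : ℕ → ℝ} {x : ι → ℝ} {r : ℕ}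

/-- The number of rejections of the step-up procedure with critical values `c 1, c 2, …` applied to
the p-values `x`: the largest `s` such that at least `s` of them are at most `c s`. -/
noncomputable def stepUp (c : ℕ → ℝ) (x : ι → ℝ) : ℕ :=
  Nat.findGreatest (fun s => s ≤ #(below univ (c s) x)) (Fintype.card ι)

lemma stepUp_le_card (c : ℕ → ℝ) (x : ι → ℝ) : stepUp c x ≤ Fintype.card ι :=
  Nat.findGreatest_le _

lemma stepUp_le_card_below (c : ℕ → ℝ) (x : ι → ℝ) :
    stepUp c x ≤ #(below univ (c (stepUp c x)) x) :=
  Nat.findGreatest_spec (P := fun s => s ≤ #(below univ (c s) x)) (Nat.zero_le _) (Nat.zero_le _)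

lemma le_stepUp_iff : r ≤ stepUp c x ↔ ∃ s, r ≤ s ∧ s ≤ #(below univ (c s) x) :=
  ⟨fun h => ⟨_, h, stepUp_le_card_below c x⟩,
    fun ⟨_, hrs, hs⟩ => hrs.trans (Nat.le_findGreatest (hs.trans (card_le_univ _)) hs)⟩

lemma card_below_stepUp (hmono : MonotoneOn c (Set.Ici 1)) (h : 1 ≤ stepUp c x) :
    #(below univ (c (stepUp c x)) x) = stepUp c x := by
  refine (stepUp_le_card_below c x).antisymm' (not_lt.1 fun hlt => ?_)
  have hle : c (stepUp c x) ≤ c (stepUp c x + 1) := hmono h (Nat.le_add_left 1 _) (Nat.le_succ _)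
  have hcard := card_le_card (below_subset_below univ hle x)
  exact (Nat.lt_succ_self _).not_ge
    (le_stepUp_iff.2 ⟨_, le_rfl, (Nat.succ_le_of_lt hlt).trans hcard⟩)

lemma stableBelow_le_stepUp (hmono : MonotoneOn c (Set.Ici 1)) (hr : 1 ≤ r) :
    StableBelow (c r) {x : ι → ℝ | r ≤ stepUp c x} := by
  intro x y hx hyx
  obtain ⟨s, hrs, hs⟩ := le_stepUp_iff.1 hx
  refine le_stepUp_iff.2 ⟨s, hrs, hs.trans (card_le_card fun i hi => ?_)⟩
  have hxi : x i ≤ c s := (mem_below.1 hi).2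
  exact mem_below.2 ⟨mem_univ i, (hyx i).trans (sup_le hxi (hmono hr (hr.trans hrs) hrs))⟩

lemma measurable_stepUp {Ω : Type*} [MeasurableSpace Ω] {X : Ω → ι → ℝ} (hX : Measurable X)
    {c : Ω → ℕ → ℝ} (hc : Measurable c) : Measurable fun ω => stepUp (c ω) (X ω) := by
  refine measurable_findGreatest fun s _ => ?_
  have hbelow := measurable_below hX univ ((measurable_pi_apply s).comp hc)
  exact (MeasurableSet.of_discrete (s := {V : Finset ι | s ≤ #V})).preimage hbelow

end StepUp

lemma integrable_truncCount_div {Ω ι : Type*} [MeasurableSpace Ω] {μ : Measure Ω}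
    [IsFiniteMeasure μ] [Finite ι] {F : Ω → Finset ι} (hF : Measurable F) {R : Ω → ℕ}
    (hR : Measurable R) (k : ℕ) : Integrable (fun ω => truncCount k #(F ω) / (R ω : ℝ)) μ := by
  have := Fintype.ofFinite ι
  have hmeas : Measurable fun p : Finset ι × ℕ => truncCount k #p.1 / (p.2 : ℝ) := .of_discrete
  refine .of_bound (C := Fintype.card ι) (hmeas.comp (hF.prodMk hR)).aestronglyMeasurable
    (.of_forall fun ω => ?_)
  have hcard : truncCount k #(F ω) ≤ Fintype.card ι :=
    (truncCount_le k _).trans (Nat.cast_le.2 (card_le_univ _))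
  rw [Real.norm_of_nonneg (div_nonneg (truncCount_nonneg k _) (Nat.cast_nonneg _))]
  rcases (R ω).eq_zero_or_pos with h | h
  · simp [h]
  · exact (div_le_self (truncCount_nonneg k _) (by exact_mod_cast h)).trans hcard

namespace PValues

variable {Ω ι : Type*} [MeasurableSpace Ω] [Fintype ι] {μ : Measure Ω}
  {X : Ω → ι → ℝ} {N : Finset ι} {lam : ℝ} {c : ℕ → ℝ} {r : ℕ}

/-- The expectation of `truncCount k #(below N t X)` on the event that the step-up procedure
with critical values `c` rejects at least `r` hypotheses. -/
noncomputable def tailMean (X : Ω → ι → ℝ) (N : Finset ι) (μ : Measure Ω) (c : ℕ → ℝ) (k r : ℕ)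
    (t : ℝ) : ℝ :=
  ∫ ω in X ⁻¹' {x | r ≤ stepUp c x}, truncCount k #(below N t (X ω)) ∂μ

lemma tailMean_nonneg (X : Ω → ι → ℝ) (N : Finset ι) (μ : Measure Ω) (c : ℕ → ℝ) (k r : ℕ)
    (t : ℝ) : 0 ≤ tailMean X N μ c k r t :=
  integral_nonneg fun _ => truncCount_nonneg _ _

lemma measurableSet_le_stepUp (c : ℕ → ℝ) (r : ℕ) :
    MeasurableSet {x : ι → ℝ | r ≤ stepUp c x} :=
  (MeasurableSet.of_discrete (s := Set.Ici r)).preimage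
    (measurable_stepUp measurable_id measurable_const)

variable [IsProbabilityMeasure μ]

lemma tailMean_le (h : PValues X N μ lam) (k r : ℕ) {t : ℝ} (ht : t ∈ Set.Icc 0 lam) :
    tailMean X N μ c k r t ≤ #N * Gtilde k #N t := by
  rw [← h.integral_truncCount ht]
  exact setIntegral_le_integral (h.integrable_comp_card_below t _)
    (.of_forall fun ω => truncCount_nonneg _ _)

lemma setIntegral_stepUp_eq (h : PValues X N μ lam) (k r : ℕ) (t : ℝ) :
    ∫ ω in X ⁻¹' (stepUp c ⁻¹' {r}), truncCount k #(below N t (X ω)) ∂μ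
      = tailMean X N μ c k r t - tailMean X N μ c k (r + 1) t := by
  have hdiff : X ⁻¹' (stepUp c ⁻¹' {r})
      = X ⁻¹' {x | r ≤ stepUp c x} \ X ⁻¹' {x | r + 1 ≤ stepUp c x} := by
    ext ω
    simp only [Set.mem_preimage, Set.mem_singleton_iff, Set.mem_sdiff, Set.mem_ofPred_eq]
    omega
  have hsub : X ⁻¹' {x | r + 1 ≤ stepUp c x} ⊆ X ⁻¹' {x | r ≤ stepUp c x} :=
    fun ω hω => (Nat.le_succ r).trans hω
  rw [hdiff, setIntegral_sdiff (h.measurable (measurableSet_le_stepUp c _))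
    (h.integrable_comp_card_below t _).integrableOn hsub]
  rfl

lemma tailMean_mul_le (h : PValues X N μ 1) (hc : ∀ r, 1 ≤ r → c r ∈ Set.Ioc 0 1)
    (hmono : MonotoneOn c (Set.Ici 1)) (hr : 1 ≤ r) (k : ℕ) :
    tailMean X N μ c k (r + 1) (c (r + 1)) * (#N * Gtilde k #N (c r))
      ≤ tailMean X N μ c k (r + 1) (c r) * (#N * Gtilde k #N (c (r + 1))) := by
  have hr' : 1 ≤ r + 1 := Nat.le_add_left 1 r
  exact h.setIntegral_truncCount_mul_le (hc r hr).1.le (hmono hr hr' r.le_succ) (hc _ hr')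
    (measurableSet_le_stepUp c _) (stableBelow_le_stepUp hmono hr') k

/-- The expectation of `truncCount k #(below N (c r) X)` on the event that the step-up procedure
rejects at least `r` hypotheses, relative to its unrestricted expectation. -/
noncomputable def tailRatio (X : Ω → ι → ℝ) (N : Finset ι) (μ : Measure Ω) (c : ℕ → ℝ)
    (k r : ℕ) : ℝ :=
  tailMean X N μ c k r (c r) / (#N * Gtilde k #N (c r))

lemma setIntegral_stepUp_eq_le (h : PValues X N μ 1) (hc : ∀ r, 1 ≤ r → c r ∈ Set.Ioc 0 1)
    (hmono : MonotoneOn c (Set.Ici 1)) {k : ℕ} (hkN : k ≤ #N) (hN : 0 < #N) {γ : ℝ}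
    (hγ : Gtilde k #N (c r) ≤ r * γ) (hr : 1 ≤ r) :
    ∫ ω in X ⁻¹' (stepUp c ⁻¹' {r}), truncCount k #(below N (c r) (X ω)) / (r : ℝ) ∂μ
      ≤ #N * γ * (tailRatio X N μ c k r - tailRatio X N μ c k (r + 1)) := by
  have hmean_pos {s : ℕ} (hs : 1 ≤ s) : 0 < #N * Gtilde k #N (c s) :=
    mul_pos (Nat.cast_pos.2 hN) (Gtilde_pos hkN (hc s hs))
  have hr0 : (0 : ℝ) < r := by exact_mod_cast hr
  have hscale : (r : ℝ)⁻¹ ≤ #N * γ / (#N * Gtilde k #N (c r)) := by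
    rw [inv_le_iff_one_le_mul₀ hr0, div_mul_eq_mul_div, one_le_div (hmean_pos hr)]
    linarith [mul_le_mul_of_nonneg_left hγ (Nat.cast_nonneg (α := ℝ) #N)]
  have hratio : tailRatio X N μ c k (r + 1)
      ≤ tailMean X N μ c k (r + 1) (c r) / (#N * Gtilde k #N (c r)) :=
    (div_le_div_iff₀ (hmean_pos (Nat.le_add_left 1 r)) (hmean_pos hr)).2
      (h.tailMean_mul_le hc hmono hr k)
  have hγ0 : 0 ≤ γ := by
    refine nonneg_of_mul_nonneg_right ((Gtilde_pos hkN (hc r hr)).le.trans hγ) hr0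
  calc ∫ ω in X ⁻¹' (stepUp c ⁻¹' {r}), truncCount k #(below N (c r) (X ω)) / (r : ℝ) ∂μ
      = (∫ ω in X ⁻¹' (stepUp c ⁻¹' {r}), truncCount k #(below N (c r) (X ω)) ∂μ) * (r : ℝ)⁻¹ :=
        integral_mul_const _ _
    _ ≤ (∫ ω in X ⁻¹' (stepUp c ⁻¹' {r}), truncCount k #(below N (c r) (X ω)) ∂μ)
          * (#N * γ / (#N * Gtilde k #N (c r))) :=
        mul_le_mul_of_nonneg_left hscale (integral_nonneg fun _ => truncCount_nonneg _ _)
    _ = #N * γ * (tailRatio X N μ c k r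
          - tailMean X N μ c k (r + 1) (c r) / (#N * Gtilde k #N (c r))) := by
        rw [h.setIntegral_stepUp_eq, tailRatio]
        ring
    _ ≤ _ := by gcongr

lemma integral_stepUp_eq_sum (h : PValues X N μ lam) (c : ℕ → ℝ) (k : ℕ) :
    ∫ ω, truncCount k #(below N (c (stepUp c (X ω))) (X ω)) / (stepUp c (X ω) : ℝ) ∂μ
      = ∑ r ∈ range (Fintype.card ι), ∫ ω in X ⁻¹' (stepUp c ⁻¹' {r + 1}),
          truncCount k #(below N (c (r + 1)) (X ω)) / ((r + 1 : ℕ) : ℝ) ∂μ := by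
  have hstep : Measurable fun ω => stepUp c (X ω) :=
    measurable_stepUp h.measurable measurable_const
  have hlevel : Measurable fun ω => c (stepUp c (X ω)) := Measurable.of_discrete.comp hstep
  have hfiber (r : ℕ) :
      ∫ ω in (fun ω => stepUp c (X ω)) ⁻¹' {r},
          truncCount k #(below N (c (stepUp c (X ω))) (X ω)) / (stepUp c (X ω) : ℝ) ∂μ
        = ∫ ω in X ⁻¹' (stepUp c ⁻¹' {r}), truncCount k #(below N (c r) (X ω)) / (r : ℝ) ∂μ :=
    setIntegral_congr_fun (hstep (measurableSet_singleton r)) fun ω hω => by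
      simp only [Set.mem_singleton_iff.1 hω]
  rw [integral_eq_sum_setIntegral_fiber (F := fun ω => stepUp c (X ω))
    (fun ω => mem_range.2 (Nat.lt_succ_of_le (stepUp_le_card c (X ω))))
    (fun r _ => hstep (measurableSet_singleton r))
    (integrable_truncCount_div (measurable_below h.measurable N hlevel) hstep k)]
  simp only [hfiber]
  rw [sum_range_succ']
  simp only [Nat.cast_zero, div_zero, integral_zero, add_zero]

/-- The `k`-FDR bound for step-up procedures. If no hypothesis is rejected, the fraction is `0 / 0`,
hence `0`. -/
theorem integral_stepUp_le (h : PValues X N μ 1) (hc : ∀ r, 1 ≤ r → c r ∈ Set.Ioc 0 1)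
    (hmono : MonotoneOn c (Set.Ici 1)) {k : ℕ} {γ : ℝ}
    (hγ : ∀ r : ℕ, 1 ≤ r → Gtilde k #N (c r) ≤ r * γ) :
    ∫ ω, truncCount k #(below N (c (stepUp c (X ω))) (X ω)) / (stepUp c (X ω) : ℝ) ∂μ
      ≤ #N * γ := by
  have hγ0 : 0 ≤ γ := by
    simpa using (Gtilde_nonneg k #N (Set.Ioc_subset_Icc_self (hc 1 le_rfl))).trans (hγ 1 le_rfl)
  by_cases hkN : 0 < #N ∧ k ≤ #N
  swap
  · have hzero (v : ℕ) (hv : v ≤ #N) : truncCount k v = 0 := by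
      rcases Nat.eq_zero_or_pos v with rfl | hpos
      · exact truncCount_zero k
      · exact if_neg fun hkv => hkN ⟨hpos.trans_le hv, hkv.trans hv⟩
    simp only [hzero _ (card_le_card (below_subset N _ _)), zero_div, integral_zero]
    positivity
  rw [h.integral_stepUp_eq_sum]
  calc _ ≤ ∑ r ∈ range (Fintype.card ι), #N * γ * (tailRatio X N μ c k (r + 1)
          - tailRatio X N μ c k (r + 1 + 1)) :=
        sum_le_sum fun r _ => h.setIntegral_stepUp_eq_le hc hmono hkN.2 hkN.1
          (hγ _ (Nat.le_add_left 1 r)) (Nat.le_add_left 1 r)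
    _ = #N * γ * (tailRatio X N μ c k 1 - tailRatio X N μ c k (Fintype.card ι + 1)) := by
        rw [← mul_sum, sum_range_sub' fun r => tailRatio X N μ c k (r + 1)]
    _ ≤ #N * γ * (1 - 0) := by
        have hmean (r : ℕ) (hr : 1 ≤ r) : 0 ≤ #N * Gtilde k #N (c r) :=
          mul_nonneg (Nat.cast_nonneg _) (Gtilde_pos hkN.2 (hc r hr)).le
        gcongr
        · exact div_le_one_of_le₀ (h.tailMean_le k 1 (Set.Ioc_subset_Icc_self (hc 1 le_rfl)))
            (hmean 1 le_rfl)
        · exact div_nonneg (tailMean_nonneg X N μ c k _ _) (hmean _ (Nat.le_add_left 1 _))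
    _ = #N * γ := by ring

end PValues

/-! ### The two-stage procedure -/

section TwoStage

variable {n : ℕ}

lemma orderStat_le_iff {x : Fin n → ℝ} {i : Fin n} {t : ℝ} :
    orderStat x i ≤ t ↔ (i : ℕ) < #(below univ t x) := by
  have hcard : #{i | (x ∘ Tuple.sort x) i ≤ t} = #(below univ t x) :=
    card_equiv (Tuple.sort x) fun i => by simp
  rw [← hcard, Tuple.lt_card_le_iff_apply_le_of_monotone (Tuple.monotone_sort x)]
  rfl

lemma firstStage_eq (lam : ℝ) (x : Fin n → ℝ) : firstStage lam x = #(below univ lam x) := by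
  refine eq_of_forall_le_iff fun r => ?_
  rcases Nat.eq_zero_or_pos r with rfl | hr
  · simp
  rw [firstStage, Finset.le_sup_iff hr]
  simp only [mem_filter_univ, orderStat_le_iff]
  refine ⟨fun ⟨i, hi, hri⟩ => hri.trans hi, fun h => ?_⟩
  have hn : r ≤ n := by simpa using h.trans (card_le_univ _)
  exact ⟨⟨r - 1, by omega⟩, by change r - 1 < _; omega, by change r ≤ r - 1 + 1; omega⟩

lemma secondStage_eq {k : ℕ} {α lam : ℝ} {x : Fin n → ℝ}
    (hcrit : ∀ s, crit k n α lam s (firstStage lam x) ≤ lam) :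
    secondStage k α lam x = stepUp (fun s => crit k n α lam s (firstStage lam x)) x := by
  refine eq_of_forall_le_iff fun r => ?_
  rcases Nat.eq_zero_or_pos r with rfl | hr
  · simp
  rw [secondStage, Finset.le_sup_iff hr, le_stepUp_iff]
  simp only [mem_filter_univ, orderStat_le_iff]
  refine ⟨fun ⟨i, hi, hri⟩ => ⟨i + 1, hri, hi.2⟩, fun ⟨s, hrs, hs⟩ => ?_⟩
  have hn : s ≤ n := by simpa using hs.trans (card_le_univ _)
  have hfirst : s ≤ firstStage lam x :=
    hs.trans ((card_le_card (below_subset_below univ (hcrit s) x)).trans_eq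
      (firstStage_eq lam x).symm)
  obtain ⟨s, rfl⟩ : ∃ s', s = s' + 1 := ⟨s - 1, by omega⟩
  exact ⟨⟨s, hn⟩, ⟨hfirst, hs⟩, hrs⟩

lemma card_rejected (k : ℕ) (α lam : ℝ) {x : Fin n → ℝ} (h : secondStage k α lam x ≤ n) :
    #(rejected k α lam x) = secondStage k α lam x := by
  have hinj : Function.Injective (ranked x) := (Tuple.sort x).injective
  rw [rejected, card_image_of_injective _ hinj, Fin.card_filter_val_lt, min_eq_right h]

lemma rejected_eq_below {k : ℕ} {α lam : ℝ} {x : Fin n → ℝ} {t : ℝ}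
    (h : #(below univ t x) = secondStage k α lam x) : rejected k α lam x = below univ t x := by
  refine eq_of_subset_of_card_le (fun i hi => ?_) ?_
  · obtain ⟨l, hl, rfl⟩ := mem_image.1 hi
    exact mem_below.2 ⟨mem_univ _, orderStat_le_iff.2 (h ▸ (mem_filter.1 hl).2)⟩
  · have hn : secondStage k α lam x ≤ n := by simpa [← h] using card_le_univ (below univ t x)
    rw [card_rejected k α lam hn, h]

lemma below_mul (N : Finset (Fin n)) {lam : ℝ} (hlam : 0 < lam) (t : ℝ) (x : Fin n → ℝ) :
    below N (lam * t) x = below N t fun i => x i / lam := by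
  ext i
  simp only [mem_below, div_le_iff₀' hlam]

lemma stepUp_mul {lam : ℝ} (hlam : 0 < lam) (c : ℕ → ℝ) (x : Fin n → ℝ) :
    stepUp (fun s => lam * c s) x = stepUp c fun i => x i / lam := by
  simp only [stepUp, below_mul univ hlam]

/-- The level `α (1 - λ) / (λ (n - j + 1))` per rejection at which the second stage is run when the
first stage selects `j` hypotheses. -/
noncomputable def adaptiveLevel (n : ℕ) (α lam : ℝ) (j : ℕ) : ℝ :=
  α * (1 - lam) / (lam * ((n : ℝ) - j + 1))

lemma adaptiveLevel_pos {α lam : ℝ} (hα : 0 < α) (hlam : lam ∈ Set.Ioo (0 : ℝ) 1) {j : ℕ}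
    (hj : j ≤ n) : 0 < adaptiveLevel n α lam j := by
  have hjn : (j : ℝ) ≤ n := Nat.cast_le.2 hj
  exact div_pos (mul_pos hα (sub_pos.2 hlam.2)) (mul_pos hlam.1 (by linarith))

/-- The critical values of the second stage in units of `λ`, when the first stage selects `j`
hypotheses. -/
noncomputable def adaptiveCrit (k n : ℕ) (α lam : ℝ) (j s : ℕ) : ℝ :=
  cappedInv k n (s * adaptiveLevel n α lam j)

lemma crit_eq (k n : ℕ) (α lam : ℝ) (s j : ℕ) :
    crit k n α lam s j = lam * adaptiveCrit k n α lam j s := by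
  rw [crit, adaptiveCrit, adaptiveLevel, cappedInv, ← mul_div_assoc, ← mul_assoc]

lemma adaptiveCrit_le_one (k n : ℕ) (α lam : ℝ) (j s : ℕ) : adaptiveCrit k n α lam j s ≤ 1 :=
  min_le_right _ _

section AdaptiveCrit

variable {k : ℕ} {α lam : ℝ} {j s : ℕ} (hkn : k ≤ n) (hα : 0 < α)
  (hlam : lam ∈ Set.Ioo (0 : ℝ) 1)

include hα hlam

lemma natCast_mul_adaptiveLevel_pos (hj : j ≤ n) (hs : 1 ≤ s) :
    0 < s * adaptiveLevel n α lam j :=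
  mul_pos (by exact_mod_cast hs) (adaptiveLevel_pos hα hlam hj)

include hkn

lemma adaptiveCrit_mem_Ioc (hj : j ≤ n) (hs : 1 ≤ s) :
    adaptiveCrit k n α lam j s ∈ Set.Ioc (0 : ℝ) 1 :=
  cappedInv_mem_Ioc hkn (natCast_mul_adaptiveLevel_pos hα hlam hj hs)

lemma adaptiveCrit_monotoneOn (hj : j ≤ n) :
    MonotoneOn (adaptiveCrit k n α lam j) (Set.Ici 1) := fun _ hr _ hs hrs =>
  cappedInv_monotoneOn hkn (natCast_mul_adaptiveLevel_pos hα hlam hj hr)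
    (natCast_mul_adaptiveLevel_pos hα hlam hj hs)
    (mul_le_mul_of_nonneg_right (Nat.cast_le.2 hrs) (adaptiveLevel_pos hα hlam hj).le)

lemma Gtilde_adaptiveCrit_le (hj : j ≤ n) (hs : 1 ≤ s) {m : ℕ} (hm : m ≤ n) :
    Gtilde k m (adaptiveCrit k n α lam j s) ≤ s * adaptiveLevel n α lam j :=
  (Gtilde_monotone_right k
    (Set.Ioc_subset_Icc_self (adaptiveCrit_mem_Ioc hkn hα hlam hj hs)) hm).trans
    (Gtilde_cappedInv_le hkn (natCast_mul_adaptiveLevel_pos hα hlam hj hs))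

lemma kFDP_rejected (nulls : Finset (Fin n)) (x : Fin n → ℝ) :
    kFDP k nulls (rejected k α lam x)
      = truncCount k #(below nulls (adaptiveCrit k n α lam #(below univ lam x)
            (stepUp (adaptiveCrit k n α lam #(below univ lam x)) fun i => x i / lam))
          fun i => x i / lam)
        / (stepUp (adaptiveCrit k n α lam #(below univ lam x)) fun i => x i / lam : ℕ) := by
  set y : Fin n → ℝ := fun i => x i / lam
  set c := adaptiveCrit k n α lam #(below univ lam x) with hc
  have hj : #(below univ lam x) ≤ n := by simpa using card_le_univ (below univ lam x)
  have hsecond : secondStage k α lam x = stepUp c y := by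
    rw [secondStage_eq fun s => ?_]
    · simp only [crit_eq, firstStage_eq, ← hc, stepUp_mul hlam.1, y]
    · rw [crit_eq]
      exact mul_le_of_le_one_right hlam.1.le (adaptiveCrit_le_one ..)
  have hn : secondStage k α lam x ≤ n := by simpa [hsecond] using stepUp_le_card c y
  have hcard := card_rejected k α lam hn
  rcases (stepUp c y).eq_zero_or_pos with h | h
  · have hempty : rejected k α lam x = ∅ := card_eq_zero.1 (hcard.trans (hsecond.trans h))
    simp [kFDP, hempty, h]
  · have hrej : rejected k α lam x = below univ (c (stepUp c y)) y := by
      rw [← below_mul univ hlam.1]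
      refine rejected_eq_below ?_
      rw [below_mul univ hlam.1, hsecond,
        card_below_stepUp (adaptiveCrit_monotoneOn hkn hα hlam hj) h]
    have hinter : rejected k α lam x ∩ nulls = below nulls (c (stepUp c y)) y := by
      ext i
      simp [hrej, and_comm]
    rw [kFDP, hinter, hcard, hsecond, max_eq_left (by exact_mod_cast h)]
    rfl

end AdaptiveCrit

end TwoStage

/-! ### Conditioning on the first stage -/

/-- The values that the `i`-th p-value can take when the first stage at level `lam` selects exactly
the hypotheses in `W`. -/
def selectionRange {ι : Type*} [DecidableEq ι] (lam : ℝ) (W : Finset ι) (i : ι) : Set ℝ :=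
  if i ∈ W then Set.Iic lam else Set.Ioi lam

section Condition

variable {ι : Type*} [DecidableEq ι] {lam : ℝ} {N W : Finset ι}

lemma measurableSet_selectionRange (lam : ℝ) (W : Finset ι) (i : ι) :
    MeasurableSet (selectionRange lam W i) := by
  rw [selectionRange]
  split_ifs <;> measurability

variable {Ω : Type*} [Fintype ι] {X : Ω → ι → ℝ}

lemma below_univ_preimage (X : Ω → ι → ℝ) (lam : ℝ) (W : Finset ι) :
    (fun ω => below univ lam (X ω)) ⁻¹' {W}
      = ⋂ i, (fun ω => X ω i) ⁻¹' selectionRange lam W i := by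
  ext ω
  simp only [Set.mem_preimage, Set.mem_singleton_iff, Set.mem_iInter, Finset.ext_iff, mem_below,
    mem_univ, true_and, selectionRange]
  refine forall_congr' fun i => ?_
  split_ifs with hi <;> simp [hi]

variable [MeasurableSpace Ω] {μ : Measure Ω}

lemma measure_selectionRange_ne_zero (hW : μ ((fun ω => below univ lam (X ω)) ⁻¹' {W}) ≠ 0)
    (i : ι) : μ ((fun ω => X ω i) ⁻¹' selectionRange lam W i) ≠ 0 := fun h0 =>
  hW (measure_mono_null ((below_univ_preimage X lam W).subset.trans (Set.iInter_subset _ i)) h0)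

namespace PValues

lemma measureReal_cond_le (h : PValues X N μ lam) (hlam : 0 ≤ lam)
    (hW : μ ((fun ω => below univ lam (X ω)) ⁻¹' {W}) ≠ 0) {i : ι} (hi : i ∈ W ∩ N) {t : ℝ}
    (ht : t ∈ Set.Icc 0 lam) :
    μ[|(fun ω => below univ lam (X ω)) ⁻¹' {W}].real {ω | X ω i ≤ t} = lam⁻¹ * t := by
  obtain ⟨hiW, hiN⟩ := mem_inter.1 hi
  have hrange : (fun ω => X ω i) ⁻¹' selectionRange lam W i = {ω | X ω i ≤ lam} := by
    rw [selectionRange, if_pos hiW]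
    rfl
  have hinter : {ω | X ω i ≤ lam} ∩ {ω | X ω i ≤ t} = {ω | X ω i ≤ t} :=
    Set.inter_eq_right.2 fun ω hω => le_trans hω ht.2
  have hcond := cond_iInter (s := {i}) (f := fun i => {ω | X ω i ≤ t})
    h.measurable_apply h.indep_prodMk
    (fun i _ => ⟨Set.Iic t, measurableSet_Iic, rfl⟩)
    (fun i _ => measure_selectionRange_ne_zero hW i) (measurableSet_selectionRange lam W)
  simp only [mem_singleton, Set.iInter_iInter_eq_left, prod_singleton] at hcond
  rw [below_univ_preimage, measureReal_def, hcond, hrange, cond_apply (h.measurableSet_le i lam),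
    hinter, ENNReal.toReal_mul, ENNReal.toReal_inv, ← measureReal_def, ← measureReal_def,
    h.measureReal_le i hiN lam ⟨hlam, le_rfl⟩, h.measureReal_le i hiN t ht]

lemma div_cond (h : PValues X N μ lam) (hlam : 0 < lam)
    (hW : μ ((fun ω => below univ lam (X ω)) ⁻¹' {W}) ≠ 0) :
    PValues (fun ω i => X ω i / lam) (W ∩ N)
      μ[|(fun ω => below univ lam (X ω)) ⁻¹' {W}] 1 where
  measurable := h.measurable.div_const _
  indep := by
    rw [below_univ_preimage]
    exact (h.indep_prodMk.cond h.measurable_apply (measure_selectionRange_ne_zero hW)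
      (measurableSet_selectionRange lam W)).comp
        (fun _ x => x / lam) fun _ => measurable_id.div_const lam
  measureReal_le i hi t ht := by
    simp only [div_le_iff₀' hlam]
    rw [h.measureReal_cond_le hlam.le hW hi
      ⟨mul_nonneg hlam.le ht.1, mul_le_of_le_one_right hlam.le ht.2⟩, inv_mul_cancel_left₀ hlam.ne']

end PValues

end Condition

lemma setIntegral_le_of_integral_cond_le {Ω : Type*} [MeasurableSpace Ω] {μ : Measure Ω}
    [IsFiniteMeasure μ] {E : Set Ω} {u : Ω → ℝ} {C : ℝ}
    (h : μ E ≠ 0 → ∫ ω, u ω ∂μ[|E] ≤ C) : ∫ ω in E, u ω ∂μ ≤ μ.real E * C := by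
  rcases eq_or_ne (μ E) 0 with h0 | h0
  · simp [Measure.restrict_zero_set h0, measureReal_def, h0]
  · have hE : 0 < μ.real E := ENNReal.toReal_pos h0 (measure_ne_top μ E)
    have hcond := h h0
    rw [ProbabilityTheory.cond, integral_smul_measure, ENNReal.toReal_inv, ← measureReal_def,
      smul_eq_mul, inv_mul_le_iff₀ hE] at hcond
    exact hcond

lemma sum_powerset_ratio_le {ι : Type*} (N : Finset ι) {x : ℝ} (hx : x ∈ Set.Ico (0 : ℝ) 1) :
    ∑ S ∈ N.powerset, (#S : ℝ) * (1 - x) / (#N - #S + 1) * (x ^ #S * (1 - x) ^ (#N - #S)) ≤ x := by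
  rw [sum_powerset_apply_card fun m => (m : ℝ) * (1 - x) / (#N - m + 1) *
    (x ^ m * (1 - x) ^ (#N - m)), sum_range_succ']
  generalize #N = n
  have hterm (i : ℕ) (hi : i < n) :
      n.choose (i + 1) * ((i + 1 : ℕ) * (1 - x) / ((n : ℝ) - (i + 1 : ℕ) + 1)
          * (x ^ (i + 1) * (1 - x) ^ (n - (i + 1))))
        = x * (x ^ i * (1 - x) ^ (n - i) * n.choose i) := by
    have hlt : (i : ℝ) < n := Nat.cast_lt.2 hi
    have hchoose : (n.choose (i + 1) : ℝ) * (i + 1) = n.choose i * (n - i) := by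
      rw [← Nat.cast_sub hi.le]
      exact_mod_cast Nat.choose_succ_right_eq n i
    have hden : (n : ℝ) - i ≠ 0 := (sub_pos.2 hlt).ne'
    obtain ⟨d, rfl⟩ : ∃ d, n = i + 1 + d := Nat.exists_eq_add_of_lt hi |>.imp fun d h => by omega
    rw [show i + 1 + d - i = d + 1 by omega, add_tsub_cancel_left,
      eq_div_of_mul_eq hden hchoose.symm]
    push_cast
    ring
  simp only [nsmul_eq_mul, Nat.cast_zero, zero_mul, zero_div, mul_zero, add_zero]
  calc _ = ∑ i ∈ range n, x * (x ^ i * (1 - x) ^ (n - i) * n.choose i) :=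
        sum_congr rfl fun i hi => hterm i (mem_range.1 hi)
    _ ≤ ∑ i ∈ range (n + 1), x * (x ^ i * (1 - x) ^ (n - i) * n.choose i) := by
        have hx' : 0 ≤ 1 - x := sub_nonneg.2 hx.2.le
        have hx0 := hx.1
        exact sum_le_sum_of_subset_of_nonneg (range_subset_range.2 n.le_succ) fun i _ _ => by
          positivity
    _ = x := by rw [← mul_sum, ← add_pow, add_sub_cancel, one_pow, mul_one]

section Adaptive

variable {Ω : Type*} [MeasurableSpace Ω] {μ : Measure Ω} [IsProbabilityMeasure μ] {n k : ℕ}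
  {X : Ω → Fin n → ℝ} {nulls : Finset (Fin n)} {α lam : ℝ}

lemma integrable_kFDP_rejected (hkn : k ≤ n) (hα : 0 < α) (hlam : lam ∈ Set.Ioo (0 : ℝ) 1)
    (hX : Measurable X) (nulls : Finset (Fin n)) :
    Integrable (fun ω => kFDP k nulls (rejected k α lam (X ω))) μ := by
  simp only [kFDP_rejected hkn hα hlam]
  have hscaled : Measurable fun ω i => X ω i / lam := hX.div_const _
  have hfirst : Measurable fun ω => #(below univ lam (X ω)) :=
    (Measurable.of_discrete (f := card)).comp (measurable_below hX univ measurable_const)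
  have hcrit : Measurable fun ω => adaptiveCrit k n α lam #(below univ lam (X ω)) :=
    (Measurable.of_discrete (f := fun j => adaptiveCrit k n α lam j)).comp hfirst
  have hstep := measurable_stepUp hscaled hcrit
  have hlevel : Measurable fun p : ℕ × ℕ => adaptiveCrit k n α lam p.1 p.2 := .of_discrete
  exact integrable_truncCount_div
    (measurable_below hscaled nulls (hlevel.comp (hfirst.prodMk hstep))) hstep k

lemma setIntegral_kFDP_rejected_le (h : PValues X nulls μ lam) (hkn : k ≤ n) (hα : 0 < α)
    (hlam : lam ∈ Set.Ioo (0 : ℝ) 1) (W : Finset (Fin n)) :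
    ∫ ω in (fun ω => below univ lam (X ω)) ⁻¹' {W}, kFDP k nulls (rejected k α lam (X ω)) ∂μ
      ≤ μ.real ((fun ω => below univ lam (X ω)) ⁻¹' {W})
        * (#(W ∩ nulls) * adaptiveLevel n α lam #W) := by
  have hcard (V : Finset (Fin n)) : #V ≤ n := by simpa using card_le_univ V
  have hmeas : MeasurableSet ((fun ω => below univ lam (X ω)) ⁻¹' {W}) :=
    measurable_below h.measurable univ measurable_const (measurableSet_singleton W)
  refine setIntegral_le_of_integral_cond_le fun hW => ?_
  have := cond_isProbabilityMeasure hW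
  refine le_of_eq_of_le (integral_congr_ae ?_) ((h.div_cond hlam.1 hW).integral_stepUp_le
    (fun s hs => adaptiveCrit_mem_Ioc hkn hα hlam (hcard W) hs)
    (adaptiveCrit_monotoneOn hkn hα hlam (hcard W))
    (fun s hs => Gtilde_adaptiveCrit_le hkn hα hlam (hcard W) hs (hcard _)))
  filter_upwards [ae_cond_mem hmeas] with ω hω
  have hfirst : below univ lam (X ω) = W := hω
  have hnulls (s : ℕ) :
      below nulls (adaptiveCrit k n α lam #W s) (fun i => X ω i / lam)
        = below (W ∩ nulls) (adaptiveCrit k n α lam #W s) fun i => X ω i / lam := by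
    ext i
    have hle : X ω i / lam ≤ adaptiveCrit k n α lam #W s → X ω i ≤ lam := fun hi =>
      (div_le_one hlam.1).1 (hi.trans (adaptiveCrit_le_one ..))
    simp only [mem_below, mem_inter, ← hfirst, mem_univ, true_and] at hle ⊢
    tauto
  rw [kFDP_rejected hkn hα hlam, hfirst, hnulls]

lemma adaptiveLevel_card_le (hα : 0 ≤ α) (hlam : lam ∈ Set.Ioo (0 : ℝ) 1)
    (W nulls : Finset (Fin n)) :
    adaptiveLevel n α lam #W ≤ α / lam * ((1 - lam) / (#nulls - #(W ∩ nulls) + 1)) := by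
  have hcount : #W + #nulls ≤ n + #(W ∩ nulls) := by
    rw [← card_union_add_card_inter]
    exact Nat.add_le_add_right (by simpa using card_le_univ (W ∪ nulls)) _
  have hcount' : (#W : ℝ) + #nulls ≤ n + #(W ∩ nulls) := by exact_mod_cast hcount
  have hinter : (#(W ∩ nulls) : ℝ) ≤ #nulls := Nat.cast_le.2 (card_le_card inter_subset_right)
  rw [adaptiveLevel, ← div_mul_div_comm]
  have hfrac : (1 - lam) / ((n : ℝ) - #W + 1) ≤ (1 - lam) / (#nulls - #(W ∩ nulls) + 1) :=
    div_le_div_of_nonneg_left (sub_nonneg.2 hlam.2.le) (by linarith) (by linarith)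
  exact mul_le_mul_of_nonneg_left hfrac (div_nonneg hα hlam.1.le)

theorem integral_kFDP_rejected_le (h : PValues X nulls μ lam) (hkn : k ≤ n) (hα : 0 < α)
    (hlam : lam ∈ Set.Ioo (0 : ℝ) 1) :
    ∫ ω, kFDP k nulls (rejected k α lam (X ω)) ∂μ ≤ α := by
  set F : Ω → Finset (Fin n) := fun ω => below univ lam (X ω)
  have hmeas (W : Finset (Fin n)) : MeasurableSet (F ⁻¹' {W}) :=
    measurable_below h.measurable univ measurable_const (measurableSet_singleton W)
  set w : ℕ → ℝ := fun v => α / lam * (v * (1 - lam) / (#nulls - v + 1))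
  have hslice (W : Finset (Fin n)) :
      ∫ ω in F ⁻¹' {W}, kFDP k nulls (rejected k α lam (X ω)) ∂μ
        ≤ ∫ ω in F ⁻¹' {W}, w #(below nulls lam (X ω)) ∂μ := by
    have hconst : ∫ ω in F ⁻¹' {W}, w #(below nulls lam (X ω)) ∂μ
        = ∫ _ in F ⁻¹' {W}, w #(W ∩ nulls) ∂μ :=
      setIntegral_congr_fun (hmeas W) fun ω (hω : F ω = W) => by
        have hbelow : below nulls lam (X ω) = W ∩ nulls := by
          ext i
          simp [← hω, F, and_comm]
        simp only [hbelow]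
    rw [hconst, setIntegral_const, smul_eq_mul]
    refine (setIntegral_kFDP_rejected_le h hkn hα hlam W).trans
      (mul_le_mul_of_nonneg_left ?_ measureReal_nonneg)
    calc (#(W ∩ nulls) : ℝ) * adaptiveLevel n α lam #W
        ≤ #(W ∩ nulls) * (α / lam * ((1 - lam) / (#nulls - #(W ∩ nulls) + 1))) :=
          mul_le_mul_of_nonneg_left (adaptiveLevel_card_le hα.le hlam W nulls) (Nat.cast_nonneg _)
      _ = w #(W ∩ nulls) := by ring
  calc ∫ ω, kFDP k nulls (rejected k α lam (X ω)) ∂μ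
      = ∑ W, ∫ ω in F ⁻¹' {W}, kFDP k nulls (rejected k α lam (X ω)) ∂μ :=
        integral_eq_sum_setIntegral_fiber (fun _ => mem_univ _) (fun W _ => hmeas W)
          (integrable_kFDP_rejected hkn hα hlam h.measurable nulls)
    _ ≤ ∑ W, ∫ ω in F ⁻¹' {W}, w #(below nulls lam (X ω)) ∂μ := sum_le_sum fun W _ => hslice W
    _ = ∫ ω, w #(below nulls lam (X ω)) ∂μ :=
        (integral_eq_sum_setIntegral_fiber (fun _ => mem_univ _) (fun W _ => hmeas W)
          (h.integrable_comp_card_below lam w)).symm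
    _ = α / lam * ∑ S ∈ nulls.powerset, (#S : ℝ) * (1 - lam) / (#nulls - #S + 1)
          * (lam ^ #S * (1 - lam) ^ (#nulls - #S)) := by
        rw [h.integral_comp_card_below ⟨hlam.1.le, le_rfl⟩, mul_sum]
        exact sum_congr rfl fun S _ => mul_assoc _ _ _
    _ ≤ α / lam * lam :=
        mul_le_mul_of_nonneg_left (sum_powerset_ratio_le nulls (Set.Ioo_subset_Ico_self hlam))
          (div_nonneg hα.le hlam.1.le)
    _ = α := div_mul_cancel₀ _ hlam.1.ne'

end Adaptive

lemma measureReal_le_of_isUniform {Ω : Type*} [MeasurableSpace Ω] {μ : Measure Ω} {X : Ω → ℝ}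
    (hX : pdf.IsUniform X (Set.Ioo 0 1) μ volume) {t : ℝ} (ht : t ∈ Set.Ico (0 : ℝ) 1) :
    μ.real {ω | X ω ≤ t} = t := by
  have hinter : Set.Ioo (0 : ℝ) 1 ∩ Set.Iic t = Set.Ioc 0 t := by
    ext s
    simp only [Set.mem_inter_iff, Set.mem_Ioo, Set.mem_Iic, Set.mem_Ioc]
    exact ⟨fun h => ⟨h.1.1, h.2⟩, fun h => ⟨⟨h.1, h.2.trans_lt ht.2⟩, h.2⟩⟩
  have hpre : μ {ω | X ω ≤ t}
      = volume (Set.Ioo (0 : ℝ) 1 ∩ Set.Iic t) / volume (Set.Ioo (0 : ℝ) 1) :=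
    hX.measure_preimage (by simp) (by simp) measurableSet_Iic
  rw [measureReal_def, hpre, hinter, Real.volume_Ioc, Real.volume_Ioo, sub_zero, sub_zero,
    ENNReal.ofReal_one, div_one, ENNReal.toReal_ofReal ht.1]

end KFDR

theorem theorem4p2_general {Ω : Type*} [MeasurableSpace Ω] (μ : Measure Ω)
    [IsProbabilityMeasure μ] (n k : ℕ) (hkn : k ≤ n)
    (α : ℝ) (hα : 0 < α) (lam : ℝ) (hlam : lam ∈ Set.Ioo (0 : ℝ) 1)
    (p : Fin n → Ω → ℝ) (hmeas : ∀ i, Measurable (p i)) (hindep : iIndepFun p μ)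
    (nulls : Finset (Fin n))
    (hnull : ∀ i ∈ nulls, ∀ t ∈ Set.Icc 0 lam, μ.real {ω | p i ω ≤ t} = t) :
    KFDR.ControlsKFDR μ k α nulls p (KFDR.rejected k α lam) :=
  have h : KFDR.PValues (fun ω i => p i ω) nulls μ lam :=
    ⟨measurable_pi_iff.2 hmeas, hindep, hnull⟩
  ⟨KFDR.integrable_kFDP_rejected hkn hα hlam h.measurable nulls,
    KFDR.integral_kFDP_rejected_le h hkn hα hlam⟩

theorem theorem4p2 {Ω : Type*} [MeasurableSpace Ω] (μ : Measure Ω) [IsProbabilityMeasure μ]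
    (n k : ℕ) (hk : 1 ≤ k) (hkn : k ≤ n)
    (α : ℝ) (hα : 0 < α) (lam : ℝ) (hlam : lam ∈ Set.Ioo (0 : ℝ) 1)
    (p : Fin n → Ω → ℝ) (hmeas : ∀ i, Measurable (p i)) (hindep : iIndepFun p μ)
    (nulls : Finset (Fin n))
    (hnull : ∀ i ∈ nulls, pdf.IsUniform (p i) (Set.Ioo 0 1) μ volume) :
    KFDR.ControlsKFDR μ k α nulls p (KFDR.rejected k α lam) :=
  theorem4p2_general μ n k hkn α hα lam hlam p hmeas hindep nulls fun i hi _ ht =>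
    KFDR.measureReal_le_of_isUniform (hnull i hi) ⟨ht.1, ht.2.trans_lt hlam.2⟩
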